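/- Notation. Let $I=[0,1]$ with Lebesgue measure $\lambda$. $\operatorname{Diff}^1_+(I)$ is the group of orientation-preserving $C^1$ diffeomorphisms of $I$ (with $C^1$ inverse, one-sided derivatives at the end points), with the $C^1$ topology. $\operatorname{HomeoLeb}_+(I)$ is the group of orientation-preserving homeomorphisms $\varphi$ of $I$ such that $\varphi_*\lambda$ has the same null sets as $\lambda$, with the topology of uniform convergence; it contains $\operatorname{Diff}^1_+(I)$. Both groups carry their Borel $\sigma$-algebras. Two measures are equivalent if they have the same null sets. A locally compact (Hausdorff) group $G$ has Kazhdan's property $(T)$ if for every (strongly continuous) unitary representation $\rho$ of $G$ on a complex Hilbert space $V$ there is a compact set $C\subseteq G$ such that for every $\epsilon>0$ there is $\delta>0$ with the following property: if $v\in V$ satisfies $\|\rho(g)v-v\|\le\delta\|v\|$ for all $g\in C$, then there is a $\rho(G)$-invariant $w\in V$ with $\|w\|=\|v\|$ and $\|w-v\|\le\epsilon\|v\|$. A Borel $G$-space is a standard Borel space $M$ with an action of $G$ for which $G\times M\to M$ is Borel. Let $\mu$ be a $G$-invariant probability measure on $M$. For a group $H$ as above, a Borel function $\alpha\colon G\times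 M\to H$ is a Borel cocycle if for all $g,h\in G$ we have $\alpha(gh,m)=\alpha(g,hm)\,\alpha(h,m)$ for $\mu$-a.e. $m$. Borel cocycles $\alpha,\beta$ are cohomologous (as $H$-valued cocycles) if there is a Borel function $\phi\colon M\to H$ such that for each $g\in G$ we have $\beta(g,m)=\phi(gm)^{-1}\alpha(g,m)\phi(m)$ for $\mu$-a.e. $m$. For $H=\operatorname{Diff}^1_+(I)$, $M\times_\alpha I$ denotes $M\times I$ with the transformations $g\cdot(m,s)=(gm,\alpha(g,m)s)$, $g\in G$; a measure is $G$-invariant if each of them preserves it. Theorem. Let $G$ be a locally compact group with Kazhdan's property $(T)$, let $M$ be a Borel $G$-space with invariant probability measure $\mu$, and let $\alpha\colon G\times M\to\operatorname{Diff}^1_+(I)$ be a Borel cocycle. Then there is a $G$-invariant probability measure $\nu$ on $M\times_\alpha I$ such that $\nu$ is equivalent to $\mu\times\lambda$ and $\nu$ projects to $\mu$ on $M$. Moreover, $\alpha$, regarded as a Borel cocycle into $\operatorname{HomeoLeb}_+(I)$, is cohomologous to the trivial cocycle. -/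

import Mathlib

open MeasureTheory Set
open scoped unitInterval

universe u v

noncomputable section

namespace WitteZimmer

/-! ### Kazhdan's property (T) -/

/-- Kazhdan's property (T) of a locally compact group `G`. A unitary representation of `G` on a
complex Hilbert space `V` is a homomorphism from `G` to the group of surjective linear isometries
of `V` that is strongly continuous. -/
def HasPropertyT (G : Type u) [Group G] [TopologicalSpace G] : Prop :=
  ∀ (V : Type u) [NormedAddCommGroup V] [InnerProductSpace ℂ V] [CompleteSpace V]
    (ρ : G →* (V ≃ₗᵢ[ℂ] V)), (∀ v : V, Continuous fun g => ρ g v) →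
    ∃ C : Set G, IsCompact C ∧ ∀ ε : ℝ, 0 < ε → ∃ δ : ℝ, 0 < δ ∧
      ∀ v : V, (∀ g ∈ C, ‖ρ g v - v‖ ≤ δ * ‖v‖) →
        ∃ w : V, (∀ g : G, ρ g w = w) ∧ ‖w‖ = ‖v‖ ∧ ‖w - v‖ ≤ ε * ‖v‖

/-! ### Cocycles -/

section Cocycle

variable {G : Type*} [Group G] {M : Type*} [MeasurableSpace M] [MulAction G M]
  {H : Type*} [Group H] [MeasurableSpace H]

/-- A Borel cocycle `G × M → H` over a `G`-space `M` with measure `μ`: a Borel function that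
satisfies the cocycle identity for all `g, h` and almost every `m`. -/
def IsBorelCocycle [MeasurableSpace G] (μ : Measure M) (α : G × M → H) : Prop :=
  Measurable α ∧ ∀ g h : G, ∀ᵐ m ∂μ, α (g * h, m) = α (g, h • m) * α (h, m)

/-- Two cocycles are cohomologous (as `H`-valued cocycles) through a Borel map `φ : M → H`. -/
def Cohomologous (μ : Measure M) (α β : G × M → H) : Prop :=
  ∃ φ : M → H, Measurable φ ∧
    ∀ g : G, ∀ᵐ m ∂μ, β (g, m) = (φ (g • m))⁻¹ * α (g, m) * φ m

end Cocycle

/-! ### Groups of homeomorphisms of the unit interval -/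

/-- The extension of `f : I → I` to a real function, constant on either side of `I`. -/
def extendReal (f : I ≃ₜ I) : ℝ → ℝ :=
  IccExtend (zero_le_one (α := ℝ)) fun s : I => (f s : ℝ)

lemma extendReal_coe (f : I ≃ₜ I) (s : I) : extendReal f s = f s := IccExtend_val _ _ s

lemma mapsTo_extendReal (f : I ≃ₜ I) : MapsTo (extendReal f) (Icc 0 1) (Icc 0 1) := fun x hx => by
  rw [show x = ((⟨x, hx⟩ : I) : ℝ) from rfl, extendReal_coe]
  exact (f _).2

/-- `f` is continuously differentiable on `I` (with one-sided derivatives at the end points). -/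
def IsC1 (f : I ≃ₜ I) : Prop := ContDiffOn ℝ 1 (extendReal f) (Icc 0 1)

lemma IsC1.mul {f g : I ≃ₜ I} (hf : IsC1 f) (hg : IsC1 g) : IsC1 (f * g) := by
  refine (ContDiffOn.comp hf hg (mapsTo_extendReal g)).congr fun x hx => ?_
  rw [show x = ((⟨x, hx⟩ : I) : ℝ) from rfl, Function.comp_apply, extendReal_coe, extendReal_coe, extendReal_coe]
  rfl

lemma isC1_one : IsC1 1 := by
  refine contDiffOn_id.congr fun x hx => ?_
  rw [show x = ((⟨x, hx⟩ : I) : ℝ) from rfl, extendReal_coe]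
  rfl

lemma strictMono_inv {f : I ≃ₜ I} (hf : StrictMono f) : StrictMono (f⁻¹ : I ≃ₜ I) :=
  fun a b hab => by
    rw [← hf.lt_iff_lt]
    simpa using hab

/-- The group of orientation-preserving `C¹` diffeomorphisms of `I`, as a subgroup of the group of
homeomorphisms of `I`. -/
def diffSubgroup : Subgroup (I ≃ₜ I) where
  carrier := {f | StrictMono f ∧ IsC1 f ∧ IsC1 f⁻¹}
  mul_mem' := by
    rintro f g ⟨h₁, h₂, h₃⟩ ⟨k₁, k₂, k₃⟩
    exact ⟨h₁.comp k₁, h₂.mul k₂, by rw [mul_inv_rev]; exact k₃.mul h₃⟩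
  one_mem' := ⟨strictMono_id, isC1_one, by rw [inv_one]; exact isC1_one⟩
  inv_mem' := by
    rintro f ⟨h₁, h₂, h₃⟩
    exact ⟨strictMono_inv h₁, h₃, by rwa [inv_inv]⟩

/-- `Diff¹₊(I)`. -/
def DiffPlus : Type := diffSubgroup

instance : Group DiffPlus := inferInstanceAs (Group diffSubgroup)

/-- The homeomorphism of `I` underlying an element of `Diff¹₊(I)`. -/
def DiffPlus.toHomeo : DiffPlus →* (I ≃ₜ I) := diffSubgroup.subtype

/-- The derivative of an element of `Diff¹₊(I)`, as a continuous function on `I`. -/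
def DiffPlus.derivative (f : DiffPlus) : C(I, ℝ) where
  toFun s := derivWithin (extendReal f.toHomeo) (Icc 0 1) s
  continuous_toFun :=
    ((f.2.2.1 : IsC1 f.toHomeo).continuousOn_derivWithin
      (uniqueDiffOn_Icc zero_lt_one) le_rfl).domRestrict

/-- The `C¹` topology on `Diff¹₊(I)`: uniform convergence of maps and of their derivatives. -/
instance : TopologicalSpace DiffPlus :=
  .induced (fun f => ((f.toHomeo : C(I, I)), f.derivative)) inferInstance

instance : MeasurableSpace DiffPlus := borel DiffPlus

instance : BorelSpace DiffPlus := ⟨rfl⟩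

/-- The group of orientation-preserving homeomorphisms `φ` of `I` such that `φ_* λ` has the same
null sets as Lebesgue measure `λ`, as a subgroup of the group of homeomorphisms of `I`. -/
def homeoLebSubgroup : Subgroup (I ≃ₜ I) where
  carrier := {φ | StrictMono φ ∧ (volume : Measure I).map φ ≪ volume ∧
    (volume : Measure I) ≪ volume.map φ}
  mul_mem' := by
    rintro f g ⟨h₁, h₂, h₃⟩ ⟨k₁, k₂, k₃⟩
    have e : (volume : Measure I).map (f * g : I ≃ₜ I) = (volume.map g).map f :=
      (Measure.map_map f.continuous.measurable g.continuous.measurable).symm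
    refine ⟨h₁.comp k₁, ?_, ?_⟩ <;> rw [e]
    · exact (k₂.map f.continuous.measurable).trans h₂
    · exact h₃.trans (k₃.map f.continuous.measurable)
  one_mem' := by
    have e : (volume : Measure I).map (1 : I ≃ₜ I) = volume := Measure.map_id
    exact ⟨strictMono_id, by rw [e], by rw [e]⟩
  inv_mem' := by
    rintro f ⟨h₁, h₂, h₃⟩
    have hm : Measurable (f⁻¹ : I ≃ₜ I) := (f⁻¹ : I ≃ₜ I).continuous.measurable
    have e : ((volume : Measure I).map f).map (f⁻¹ : I ≃ₜ I) = volume := by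
      rw [Measure.map_map hm f.continuous.measurable,
        show ((f⁻¹ : I ≃ₜ I) : I → I) ∘ f = id from funext fun x => by simp, Measure.map_id]
    refine ⟨strictMono_inv h₁, ?_, ?_⟩
    · simpa only [e] using h₃.map hm
    · simpa only [e] using h₂.map hm

/-- `HomeoLeb₊(I)`. -/
def HomeoLebPlus : Type := homeoLebSubgroup

instance : Group HomeoLebPlus := inferInstanceAs (Group homeoLebSubgroup)

/-- The homeomorphism of `I` underlying an element of `HomeoLeb₊(I)`. -/
def HomeoLebPlus.toHomeo : HomeoLebPlus →* (I ≃ₜ I) := homeoLebSubgroup.subtype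

/-- The topology of uniform convergence on `HomeoLeb₊(I)`. -/
instance : TopologicalSpace HomeoLebPlus :=
  .induced (fun f => (f.toHomeo : C(I, I))) inferInstance

instance : MeasurableSpace HomeoLebPlus := borel HomeoLebPlus

instance : BorelSpace HomeoLebPlus := ⟨rfl⟩

/-- A `C¹` homeomorphism of `I` maps null sets to null sets. -/
lemma IsC1.volume_image {f : I ≃ₜ I} (hf : IsC1 f) {s : Set I} (hs : volume s = 0) :
    volume (f '' s) = 0 := by
  rw [unitInterval.volume_apply] at hs ⊢
  have hd : DifferentiableOn ℝ (extendReal f) (Subtype.val '' s) :=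
    (hf.differentiableOn one_ne_zero).mono (by rintro _ ⟨x, -, rfl⟩; exact x.2)
  have := addHaar_image_eq_zero_of_differentiableOn_of_addHaar_eq_zero volume hd hs
  rwa [image_image, image_congr (fun x _ => extendReal_coe f x), ← image_image Subtype.val f] at this

lemma diffSubgroup_le : diffSubgroup ≤ homeoLebSubgroup := by
  rintro f ⟨h₁, h₂, h₃⟩
  refine ⟨h₁, Measure.AbsolutelyContinuous.mk fun s hs h => ?_,
    Measure.AbsolutelyContinuous.mk fun s hs h => ?_⟩
  · rw [Measure.map_apply f.continuous.measurable hs, ← f.image_symm]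
    exact h₃.volume_image h
  · rw [Measure.map_apply f.continuous.measurable hs] at h
    rw [← f.image_preimage s]
    exact h₂.volume_image h

/-- The inclusion of `Diff¹₊(I)` in `HomeoLeb₊(I)`. -/
def DiffPlus.toHomeoLeb : DiffPlus →* HomeoLebPlus := Subgroup.inclusion diffSubgroup_le

/-! ### The skew product -/

/-- The transformation `(m, s) ↦ (g m, α(g, m) s)` by which `g` acts on the skew product
`M ×_α I`. -/
def skewMap {G M : Type*} [SMul G M] (α : G × M → DiffPlus) (g : G) (p : M × I) : M × I :=
  (g • p.1, (α (g, p.1)).toHomeo p.2)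

end WitteZimmer

end

/-! The proof produces a density on `M ×_α I`, nonzero almost everywhere, whose product with
`μ × λ` is a `G`-invariant measure; both assertions follow from it.

`G` acts on `M ×_α I` preserving the null sets of `μ × λ`, with Jacobian the derivative of the
cocycle, so there is a Koopman representation on `L²(μ × λ)` (`NonsingularAction.koopman`). It is
strongly continuous (`continuous_of_measurable_inner`), and the squared absolute value of an
invariant vector is an invariant density. Since `L²` is separable, a countable sum of such densities
dominates all of them (`NonsingularAction.exists_invariant_density`). Let `Z` be its zero set, an
invariant set on which all invariant vectors vanish. It has to be shown that `Z` is null.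

On the section `Z_m` use the coordinate `t = λ(Z_m ∩ [0, s])`. By continuity of the derivative, a
`C¹` diffeomorphism acts near `t = 0` as multiplication by its derivative at the left end of the
essential support of `Z_m` (`DiffPlus.abs_derivative_mul_sub_integral_le`). The densities
`θ t ^ (θ - 1)` concentrate at `t = 0` as `θ → 0` and are asymptotically invariant under
multiplication by constants. Their square roots are therefore asymptotically invariant vectors
supported in `Z` (`tendsto_lintegral_fiberDensity`, `tendsto_lintegral_skewDensity`). They are
asymptotically invariant under each single group element, hence uniformly on compact sets by a Baire
category argument (`eventually_forall_mem_le_of_tendsto`). If `Z` had positive measure, their norms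
would be bounded below, and property (T) would give an invariant vector near one of them, which
cannot vanish on `Z` (`NonsingularAction.exists_invariant_ne_zero`).

Normalise the density on each fibre of `M × I → M`. The result is the invariant measure `ν`, with
conditional measures `ν_m` equivalent to `λ`. The distribution function of `ν_m` is a homeomorphism
that carries `ν_m` to `λ`, and its inverse `φ m` satisfies `φ (g m) = α (g, m) φ m`, because
`α (g, m)` carries `ν_m` to `ν_{g m}` and preserves the order (`cohomologous_one`).
-/

noncomputable section

namespace WitteZimmer

open Filter Topology
open scoped ENNReal

/-! ### Property (T): separable representations and almost invariant sequences -/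

lemma countable_of_orthonormal {V : Type*} [NormedAddCommGroup V] [InnerProductSpace ℂ V]
    [TopologicalSpace.SeparableSpace V] {ι : Type*} {b : ι → V} (hb : Orthonormal ℂ b) :
    Countable ι := by
  refine Pairwise.countable_of_isOpen_disjoint (s := fun i => Metric.ball (b i) (1 / 2))
    (fun i j hij => ?_) (fun _ => Metric.isOpen_ball) fun i => ⟨b i, by simp⟩
  refine Metric.ball_disjoint_ball ?_
  have h : ‖b i - b j‖ ^ 2 = 2 := by
    rw [@norm_sub_sq ℂ, hb.1, hb.1, hb.2 hij]
    norm_num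
  rw [dist_eq_norm]
  nlinarith [norm_nonneg (b i - b j)]

/-- Property (T) constrains the separable unitary representations in every universe, since a
separable Hilbert space is isometric to `ℓ²` of a countable index type, which has a copy in each
universe. -/
lemma HasPropertyT.exists_isCompact_of_separable {G : Type u} [Group G] [TopologicalSpace G]
    (hG : HasPropertyT G) {V : Type v} [NormedAddCommGroup V] [InnerProductSpace ℂ V]
    [CompleteSpace V] [TopologicalSpace.SeparableSpace V] (ρ : G →* (V ≃ₗᵢ[ℂ] V))
    (hρ : ∀ v : V, Continuous fun g => ρ g v) :
    ∃ C : Set G, IsCompact C ∧ ∀ ε : ℝ, 0 < ε → ∃ δ : ℝ, 0 < δ ∧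
      ∀ v : V, (∀ g ∈ C, ‖ρ g v - v‖ ≤ δ * ‖v‖) →
        ∃ w : V, (∀ g : G, ρ g w = w) ∧ ‖w - v‖ ≤ ε * ‖v‖ := by
  obtain ⟨s, b, hb⟩ := exists_hilbertBasis ℂ V
  have : Countable s := countable_of_orthonormal b.orthonormal
  have : Small.{u} s := Countable.toSmall s
  let c : HilbertBasis (Shrink.{u} s) ℂ V :=
    HilbertBasis.mk (b.orthonormal.comp _ (equivShrink s).symm.injective) (by
      rw [(equivShrink s).symm.surjective.range_comp, b.dense_span])
  let e := c.repr
  let τ : G →* (lp (fun _ : Shrink.{u} s => ℂ) 2 ≃ₗᵢ[ℂ] lp (fun _ : Shrink.{u} s => ℂ) 2) :=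
    { toFun := fun g => (e.symm.trans (ρ g)).trans e
      map_one' := by
        ext1 x
        simp
      map_mul' := fun g h => by
        ext1 x
        simp }
  have hτ : ∀ g x, τ g x = e (ρ g (e.symm x)) := fun _ _ => rfl
  obtain ⟨C, hC, H⟩ := hG _ τ fun x => e.continuous.comp (hρ (e.symm x))
  refine ⟨C, hC, fun ε hε => ?_⟩
  obtain ⟨δ, hδ, H⟩ := H ε hε
  refine ⟨δ, hδ, fun v hv => ?_⟩
  obtain ⟨w, hw, -, hwv⟩ := H (e v) fun g hg => by
    rw [hτ, e.symm_apply_apply, ← map_sub, e.norm_map, e.norm_map]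
    exact hv g hg
  refine ⟨e.symm w, fun g => e.injective ?_, ?_⟩
  · rw [← hτ, hw, e.apply_symm_apply]
  · rw [e.norm_map] at hwv
    rwa [← e.norm_map, map_sub, e.apply_symm_apply]

/-- A sequence of continuous length functions on a locally compact group that tends to zero
pointwise does so uniformly on compact sets, by the Baire category theorem. -/
lemma eventually_forall_mem_le_of_tendsto {G : Type*} [Group G] [TopologicalSpace G]
    [IsTopologicalGroup G] [T2Space G] [LocallyCompactSpace G] {F : ℕ → G → ℝ}
    (hF : ∀ n, Continuous (F n)) (hmul : ∀ n g h, F n (g * h) ≤ F n g + F n h)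
    (hinv : ∀ n g, F n g⁻¹ = F n g) (hlim : ∀ g, Tendsto (fun n => F n g) atTop (𝓝 0))
    {C : Set G} (hC : IsCompact C) {δ : ℝ} (hδ : 0 < δ) :
    ∀ᶠ n in atTop, ∀ g ∈ C, F n g ≤ δ := by
  have hδ' : (0 : ℝ) < δ / 3 := by positivity
  obtain ⟨N, u, hu⟩ := nonempty_interior_of_iUnion_of_closed
    (f := fun N : ℕ => ⋂ n ≥ N, {g : G | F n g ≤ δ / 3})
    (fun N => isClosed_biInter fun n _ => isClosed_le (hF n) continuous_const) (by
      refine eq_univ_of_forall fun g => ?_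
      obtain ⟨N, hN⟩ := eventually_atTop.1 ((hlim g).eventually_le_const hδ')
      exact mem_iUnion.2 ⟨N, mem_iInter₂.2 hN⟩)
  set U := interior (⋂ n ≥ N, {g : G | F n g ≤ δ / 3})
  have hU : ∀ x ∈ U, ∀ n ≥ N, F n x ≤ δ / 3 := fun x hx n hn =>
    mem_iInter₂.1 (interior_subset hx) n hn
  obtain ⟨t, -, ht⟩ := hC.elim_nhds_subcover (fun c => (fun g => u * (c⁻¹ * g)) ⁻¹' U) fun c _ =>
    (isOpen_interior.preimage (by fun_prop)).mem_nhds (by simpa using hu)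
  have hev : ∀ᶠ n in atTop, ∀ c ∈ t, F n c ≤ δ / 3 :=
    (Finset.eventually_all t).2 fun c _ => (hlim c).eventually_le_const hδ'
  filter_upwards [hev, eventually_ge_atTop N] with n hn hnN g hg
  obtain ⟨c, hc, hgc⟩ := mem_iUnion₂.1 (ht hg)
  calc F n g = F n (c * (u⁻¹ * (u * (c⁻¹ * g)))) := by congr 1; group
    _ ≤ F n c + (F n u⁻¹ + F n (u * (c⁻¹ * g))) := (hmul ..).trans (by gcongr; exact hmul ..)
    _ ≤ δ / 3 + (δ / 3 + δ / 3) := by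
      rw [hinv]
      exact add_le_add (hn c hc) (add_le_add (hU u hu n hnN) (hU _ hgc n hnN))
    _ = δ := by ring

/-- In a separable representation of a group with property (T), vectors of norm bounded below
that are asymptotically invariant under each single group element come close to invariant
vectors. -/
lemma HasPropertyT.exists_invariant_near {G : Type u} [Group G] [TopologicalSpace G]
    [IsTopologicalGroup G] [T2Space G] [LocallyCompactSpace G]
    (hG : HasPropertyT G) {V : Type v} [NormedAddCommGroup V] [InnerProductSpace ℂ V]
    [CompleteSpace V] [TopologicalSpace.SeparableSpace V] (ρ : G →* (V ≃ₗᵢ[ℂ] V))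
    (hρ : ∀ v : V, Continuous fun g => ρ g v) {x : ℕ → V} {c : ℝ} (hc : 0 < c)
    (hx : ∀ n, c ≤ ‖x n‖) (hlim : ∀ g, Tendsto (fun n => ‖ρ g (x n) - x n‖) atTop (𝓝 0))
    {ε : ℝ} (hε : 0 < ε) :
    ∃ n, ∃ w : V, (∀ g : G, ρ g w = w) ∧ ‖w - x n‖ ≤ ε * ‖x n‖ := by
  obtain ⟨C, hC, H⟩ := hG.exists_isCompact_of_separable ρ hρ
  obtain ⟨δ, hδ, H⟩ := H ε hε
  have hmul : ∀ n g h, ‖ρ (g * h) (x n) - x n‖ ≤ ‖ρ g (x n) - x n‖ + ‖ρ h (x n) - x n‖ := by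
    intro n g h
    calc ‖ρ (g * h) (x n) - x n‖ = ‖ρ g (ρ h (x n) - x n) + (ρ g (x n) - x n)‖ := by
          rw [map_mul, map_sub, LinearIsometryEquiv.coe_mul, Function.comp_apply,
            sub_add_sub_cancel]
      _ ≤ ‖ρ h (x n) - x n‖ + ‖ρ g (x n) - x n‖ := by
          refine (norm_add_le _ _).trans_eq ?_
          rw [(ρ g).norm_map]
      _ = _ := add_comm _ _
  have hinv : ∀ n g, ‖ρ g⁻¹ (x n) - x n‖ = ‖ρ g (x n) - x n‖ := fun n g => by
    rw [← (ρ g).norm_map (ρ g⁻¹ (x n) - x n), map_sub, ← Function.comp_apply (f := ρ g),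
      ← LinearIsometryEquiv.coe_mul, ← map_mul, mul_inv_cancel, map_one,
      LinearIsometryEquiv.coe_one, id, norm_sub_rev]
  obtain ⟨n, hn⟩ := (eventually_forall_mem_le_of_tendsto
    (fun n => ((hρ (x n)).sub continuous_const).norm) hmul hinv hlim hC (mul_pos hδ hc)).exists
  exact ⟨n, H (x n) fun g hg => (hn g hg).trans (by gcongr; exact hx n)⟩

/-- A weakly measurable unitary representation of a locally compact group on a separable Hilbert
space is strongly continuous: countably many of the sets where `ρ g⁻¹ v` is near a given vector
cover the group, so one of them has positive Haar measure and Steinhaus' theorem applies. -/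
lemma continuous_of_measurable_inner {G : Type*} [Group G] [TopologicalSpace G]
    [IsTopologicalGroup G] [T2Space G] [LocallyCompactSpace G] [MeasurableSpace G] [BorelSpace G]
    {V : Type*} [NormedAddCommGroup V] [InnerProductSpace ℂ V]
    [TopologicalSpace.SeparableSpace V] (ρ : G →* (V ≃ₗᵢ[ℂ] V))
    (hρ : ∀ v w : V, Measurable fun g => inner ℂ w (ρ g v)) (v : V) :
    Continuous fun g => ρ g v := by
  have hm : ∀ w : V, Measurable fun g => ‖ρ g v - w‖ := fun w => by
    have : ∀ g, ‖ρ g v - w‖ = √(‖v‖ ^ 2 - 2 * (inner ℂ w (ρ g v)).re + ‖w‖ ^ 2) := fun g => by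
      rw [← Real.sqrt_sq (norm_nonneg (ρ g v - w)), @norm_sub_sq ℂ, (ρ g).norm_map, inner_re_symm]
      rfl
    simp_rw [this]
    have := Complex.measurable_re.comp (hρ v w)
    exact (((measurable_const.sub (this.const_mul 2)).add_const _)).sqrt
  suffices h1 : ∀ ε > 0, ∀ᶠ g in 𝓝 (1 : G), ‖ρ g v - v‖ < ε by
    rw [continuous_iff_continuousAt]
    refine fun g₀ => Metric.tendsto_nhds.2 fun ε hε => ?_
    have : Tendsto (fun g => g₀⁻¹ * g) (𝓝 g₀) (𝓝 1) :=
      (continuous_const.mul continuous_id).tendsto' _ _ (by simp)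
    filter_upwards [this.eventually (h1 ε hε)] with g hg
    rw [dist_eq_norm, ← (ρ g₀⁻¹).norm_map, map_sub]
    rw [← Function.comp_apply (f := ρ g₀⁻¹) (x := v), ← LinearIsometryEquiv.coe_mul, ← map_mul,
      ← Function.comp_apply (f := ρ g₀⁻¹) (x := v), ← LinearIsometryEquiv.coe_mul, ← map_mul]
    simpa using hg
  intro ε hε
  obtain ⟨K, hK, hK1⟩ := exists_compact_mem_nhds (1 : G)
  let A : ℕ → Set G := fun n =>
    K ∩ {g | ‖ρ g⁻¹ v - TopologicalSpace.denseSeq V n‖ < ε / 2}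
  have hA : ∀ n, MeasurableSet (A n) := fun n =>
    hK.measurableSet.inter (measurableSet_lt ((hm _).comp measurable_inv) measurable_const)
  have hKA : K ⊆ ⋃ n, A n := fun g hg => by
    obtain ⟨n, hn⟩ := (TopologicalSpace.denseRange_denseSeq V).exists_mem_open
      (Metric.isOpen_ball (x := ρ g⁻¹ v) (ε := ε / 2)) ⟨_, Metric.mem_ball_self (by positivity)⟩
    exact mem_iUnion.2 ⟨n, hg, by simpa [dist_eq_norm, norm_sub_rev] using hn⟩
  obtain ⟨n, hn⟩ : ∃ n, 0 < Measure.haar (A n) := by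
    by_contra! h
    have h0 : Measure.haar (⋃ n, A n) = 0 := measure_iUnion_null fun n => nonpos_iff_eq_zero.1 (h n)
    exact (Measure.measure_pos_of_mem_nhds Measure.haar hK1).ne' (measure_mono_null hKA h0)
  have hfin : Measure.haar (A n) ≠ ⊤ :=
    ((measure_mono inter_subset_left).trans_lt hK.measure_lt_top).ne
  filter_upwards [Measure.div_mem_nhds_one_of_haar_pos_ne_top Measure.haar (A n) (hA n) hn hfin]
    with g hg
  obtain ⟨a, ha, b, hb, rfl⟩ := hg
  have h1 : ‖ρ (a / b) v - v‖ = ‖ρ b⁻¹ v - ρ a⁻¹ v‖ := by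
    rw [← (ρ a⁻¹).norm_map, map_sub, ← Function.comp_apply (f := ρ a⁻¹) (x := v),
      ← LinearIsometryEquiv.coe_mul, ← map_mul]
    simp [div_eq_mul_inv]
  rw [h1]
  have h2 : ‖ρ a⁻¹ v - TopologicalSpace.denseSeq V n‖ < ε / 2 := ha.2
  have h3 : ‖ρ b⁻¹ v - TopologicalSpace.denseSeq V n‖ < ε / 2 := hb.2
  rw [← norm_sub_rev] at h2
  linarith [norm_sub_le_norm_sub_add_norm_sub (ρ b⁻¹ v) (TopologicalSpace.denseSeq V n) (ρ a⁻¹ v)]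

/-! ### Distribution functions of diffuse measures on the interval -/

section Distribution

variable (κ : Measure I) [IsFiniteMeasure κ] [NullSingletonClass κ]

lemma continuous_real_Iic : Continuous fun s => κ.real (Iic s) := by
  have h : ∀ s, κ.real (Iic s) = ∫ x, (Iic s).indicator (fun _ => (1 : ℝ)) x ∂κ := fun s => by
    rw [integral_indicator measurableSet_Iic]
    simp
  simp_rw [h]
  refine continuous_iff_continuousAt.2 fun s₀ => continuousAt_of_dominated (bound := fun _ => 1)
    (Eventually.of_forall fun s =>
      (measurable_const.indicator measurableSet_Iic).aestronglyMeasurable)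
    (Eventually.of_forall fun s => Eventually.of_forall fun x => ?_) (integrable_const _) ?_
  · by_cases hx : x ∈ Iic s <;> simp [hx]
  · have : ∀ᵐ x ∂κ, x ≠ s₀ := by simp [ae_iff]
    filter_upwards [this] with x hx
    refine ContinuousAt.congr (f := fun _ => (Iic s₀).indicator (fun _ => (1 : ℝ)) x)
      continuousAt_const ?_
    rcases lt_or_gt_of_ne hx with h | h
    · filter_upwards [eventually_gt_nhds h] with s hs
      simp [h.le, hs.le]
    · filter_upwards [eventually_lt_nhds h] with s hs
      simp [h, hs]

omit [NullSingletonClass κ] in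
lemma monotone_real_Iic : Monotone fun s => κ.real (Iic s) := fun _ _ h =>
  measureReal_mono (Iic_subset_Iic.2 h)

omit [NullSingletonClass κ] in
lemma real_Iic_le_real_univ (s : I) : κ.real (Iic s) ≤ κ.real univ :=
  measureReal_mono (subset_univ _)

omit [IsFiniteMeasure κ] in
lemma real_Iic_zero : κ.real (Iic 0) = 0 := by
  have : Iic (0 : I) = {0} := by
    ext x
    simp [unitInterval.nonneg'.ge_iff_eq']
  simp [this, measureReal_def]

omit [IsFiniteMeasure κ] [NullSingletonClass κ] in
lemma real_Iic_one : κ.real (Iic 1) = κ.real univ := by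
  congr 1
  exact eq_univ_of_forall fun x => unitInterval.le_one'

/-- A diffuse measure on `I` is carried by its distribution function to Lebesgue measure on
`[0, κ(I)]`. -/
lemma map_real_Iic :
    κ.map (fun s => κ.real (Iic s)) = volume.restrict (Icc 0 (κ.real univ)) := by
  have hc := continuous_real_Iic κ
  refine Measure.ext_of_Iic _ _ fun c => ?_
  rw [Measure.map_apply hc.measurable measurableSet_Iic, Measure.restrict_apply measurableSet_Iic]
  rcases lt_or_ge c 0 with h0 | h0
  · have e1 : (fun s => κ.real (Iic s)) ⁻¹' Iic c = ∅ :=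
      eq_empty_of_forall_notMem fun s hs => (h0.trans_le measureReal_nonneg).not_ge hs
    have e2 : Iic c ∩ Icc 0 (κ.real univ) = ∅ :=
      eq_empty_of_forall_notMem fun s hs => (h0.trans_le hs.2.1).not_ge hs.1
    rw [e1, e2, measure_empty, measure_empty]
  have e2 : Iic c ∩ Icc 0 (κ.real univ) = Icc 0 (min c (κ.real univ)) := by
    ext x
    simp only [mem_inter_iff, mem_Iic, mem_Icc, le_min_iff]
    tauto
  rw [e2, Real.volume_Icc, sub_zero]
  rcases le_or_gt (κ.real univ) c with h1 | h1
  · have e1 : (fun s => κ.real (Iic s)) ⁻¹' Iic c = univ :=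
      eq_univ_of_forall fun s => (real_Iic_le_real_univ κ s).trans h1
    rw [e1, min_eq_right h1, ofReal_measureReal]
  · obtain ⟨s, hs, hmax⟩ := (isClosed_Iic.preimage hc).isCompact.exists_isGreatest
      (s := (fun s => κ.real (Iic s)) ⁻¹' Iic c) ⟨0, by simpa [real_Iic_zero] using h0⟩
    obtain ⟨y, hy⟩ : c ∈ range fun s => κ.real (Iic s) :=
      mem_range_of_exists_le_of_exists_ge hc ⟨0, by simpa [real_Iic_zero] using h0⟩
        ⟨1, by simpa [real_Iic_one] using h1.le⟩
    have e1 : (fun s => κ.real (Iic s)) ⁻¹' Iic c = Iic s :=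
      Subset.antisymm hmax fun x hx => (monotone_real_Iic κ hx).trans hs
    have e3 : κ.real (Iic s) = c :=
      le_antisymm hs (hy.symm.le.trans (monotone_real_Iic κ (hmax hy.le)))
    rw [e1, min_eq_left h1.le, ← e3, ofReal_measureReal]

lemma ae_real_Iic_pos : ∀ᵐ s ∂κ, 0 < κ.real (Iic s) := by
  have h : ∀ᵐ x ∂(κ.map fun s => κ.real (Iic s)), x ≠ 0 := by
    rw [map_real_Iic, ae_iff]
    simp
  filter_upwards [ae_of_ae_map (continuous_real_Iic κ).measurable.aemeasurable h] with s hs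
  exact measureReal_nonneg.lt_of_ne' hs

end Distribution

/-! ### Concentrating densities -/

/-- The density `θ t ^ (θ - 1)` on `(0, 1)` with `θ = 1 / (n + 1)`. It is a probability density that
concentrates at `0` as `n → ∞`, so slowly that dilations of `t` hardly change it. -/
def powerDensity (n : ℕ) (t : ℝ) : ℝ := (1 / (n + 1 : ℝ)) * t ^ (1 / (n + 1 : ℝ) - 1)

lemma powerDensity_nonneg (n : ℕ) {t : ℝ} (ht : 0 ≤ t) : 0 ≤ powerDensity n t := by
  unfold powerDensity
  positivity

lemma measurable_powerDensity (n : ℕ) : Measurable (powerDensity n) :=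
  (measurable_id.pow_const _).const_mul _

lemma setLIntegral_powerDensity (n : ℕ) {L : ℝ} (hL : 0 ≤ L) :
    ∫⁻ t in Icc 0 L, ENNReal.ofReal (powerDensity n t)
      = ENNReal.ofReal (L ^ (1 / (n + 1 : ℝ))) := by
  have hθ : (0 : ℝ) < 1 / (n + 1 : ℝ) := by positivity
  have hi : IntervalIntegrable (powerDensity n) volume 0 L :=
    (intervalIntegral.intervalIntegrable_rpow' (by linarith)).const_mul _
  rw [setLIntegral_congr Ioc_ae_eq_Icc.symm, ← ofReal_integral_eq_lintegral_ofReal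
    ((intervalIntegrable_iff_integrableOn_Ioc_of_le hL).1 hi)
    (ae_restrict_of_forall_mem measurableSet_Ioc fun t ht => powerDensity_nonneg n ht.1.le),
    ← intervalIntegral.integral_of_le hL]
  congr 1
  unfold powerDensity
  rw [intervalIntegral.integral_const_mul, integral_rpow (Or.inl (by linarith)), sub_add_cancel,
    Real.zero_rpow hθ.ne']
  field_simp
  simp

lemma lintegral_powerDensity_real_Iic (κ : Measure I) [IsFiniteMeasure κ] [NullSingletonClass κ]
    (n : ℕ) :
    ∫⁻ s, ENNReal.ofReal (powerDensity n (κ.real (Iic s))) ∂κ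
      = ENNReal.ofReal (κ.real univ ^ (1 / (n + 1 : ℝ))) := by
  rw [← setLIntegral_powerDensity n measureReal_nonneg, ← map_real_Iic,
    lintegral_map (measurable_powerDensity n).ennreal_ofReal (continuous_real_Iic κ).measurable]

lemma measurable_powerDensity_real_Iic (κ : Measure I) [IsFiniteMeasure κ] (n : ℕ) :
    Measurable fun s => ENNReal.ofReal (powerDensity n (κ.real (Iic s))) :=
  ((measurable_powerDensity n).comp (monotone_real_Iic κ).measurable).ennreal_ofReal

/-- The probability measures with densities `powerDensity n` in the coordinate `κ.real (Iic s)`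
concentrate where this coordinate is small and positive. -/
lemma tendsto_lintegral_powerDensity_mul (κ : Measure I) [IsFiniteMeasure κ]
    [NullSingletonClass κ] (hκ : κ.real univ ≤ 1) {h : I → ℝ} {B : ℝ} (hB : ∀ᵐ s ∂κ, h s ≤ B)
    (hsmall : ∀ η > 0, ∃ τ > 0, ∀ s, 0 < κ.real (Iic s) → κ.real (Iic s) < τ → h s ≤ η) :
    Tendsto (fun n => ∫⁻ s, ENNReal.ofReal (powerDensity n (κ.real (Iic s))) *
      ENNReal.ofReal (h s) ∂κ) atTop (𝓝 0) := by
  refine ENNReal.tendsto_nhds_zero.2 fun ε hε => ?_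
  obtain ⟨η, hη, hηε⟩ : ∃ η : ℝ, 0 < η ∧ ENNReal.ofReal η + ENNReal.ofReal η ≤ ε := by
    rcases eq_or_ne ε ⊤ with rfl | hε'
    · exact ⟨1, one_pos, le_top⟩
    · refine ⟨ε.toReal / 2, half_pos (ENNReal.toReal_pos hε.ne' hε'), ?_⟩
      rw [← ENNReal.ofReal_add (by positivity) (by positivity), add_halves,
        ENNReal.ofReal_toReal hε']
  obtain ⟨τ, hτ, hτη⟩ := hsmall η hη
  have hlim : Tendsto (fun n : ℕ => 1 / (n + 1 : ℝ) * (min τ 1)⁻¹ * max B 0) atTop (𝓝 0) := by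
    simpa using ((tendsto_one_div_add_atTop_nhds_zero_nat (𝕜 := ℝ)).mul_const
      (min τ 1)⁻¹).mul_const (max B 0)
  filter_upwards [hlim.eventually_le_const hη] with n hn
  have hθ : (0 : ℝ) < 1 / (n + 1 : ℝ) := by positivity
  have hθ1 : 1 / (n + 1 : ℝ) ≤ 1 := by
    rw [div_le_one (by positivity)]
    simp
  have hbound : ∀ᵐ s ∂κ, ENNReal.ofReal (powerDensity n (κ.real (Iic s))) * ENNReal.ofReal (h s)
      ≤ ENNReal.ofReal (powerDensity n (κ.real (Iic s))) * ENNReal.ofReal η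
        + ENNReal.ofReal η := by
    filter_upwards [hB, ae_real_Iic_pos κ] with s hs hpos
    rcases lt_or_ge (κ.real (Iic s)) τ with hlt | hge
    · exact le_add_right (by gcongr; exact hτη s hpos hlt)
    · refine le_add_left ?_
      rw [← ENNReal.ofReal_mul (powerDensity_nonneg n hpos.le)]
      refine ENNReal.ofReal_le_ofReal (le_trans ?_ hn)
      have hm : 0 < min τ 1 := by positivity
      have h1 : κ.real (Iic s) ^ (1 / (n + 1 : ℝ) - 1) ≤ (min τ 1)⁻¹ := by
        calc κ.real (Iic s) ^ (1 / (n + 1 : ℝ) - 1) ≤ (min τ 1) ^ (1 / (n + 1 : ℝ) - 1) :=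
              Real.rpow_le_rpow_of_nonpos hm ((min_le_left _ _).trans hge) (by linarith)
          _ ≤ (min τ 1) ^ (-1 : ℝ) :=
              Real.rpow_le_rpow_of_exponent_ge hm (min_le_right _ _) (by linarith)
          _ = _ := Real.rpow_neg_one _
      calc powerDensity n (κ.real (Iic s)) * h s
          ≤ powerDensity n (κ.real (Iic s)) * max B 0 := by
            gcongr
            · exact powerDensity_nonneg n hpos.le
            · exact hs.trans (le_max_left _ _)
        _ ≤ _ := by
            unfold powerDensity
            gcongr
  calc _ ≤ ∫⁻ s, (ENNReal.ofReal (powerDensity n (κ.real (Iic s))) * ENNReal.ofReal η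
        + ENNReal.ofReal η) ∂κ := lintegral_mono_ae hbound
    _ = ENNReal.ofReal (κ.real univ ^ (1 / (n + 1 : ℝ))) * ENNReal.ofReal η
        + ENNReal.ofReal η * κ univ := by
      rw [lintegral_add_right _ measurable_const, lintegral_mul_const' _ _ ENNReal.ofReal_ne_top,
        lintegral_powerDensity_real_Iic, lintegral_const]
    _ ≤ 1 * ENNReal.ofReal η + ENNReal.ofReal η * 1 := by
      gcongr
      · exact ENNReal.ofReal_le_one.2 (Real.rpow_le_one measureReal_nonneg hκ hθ.le)
      · rw [← ofReal_measureReal (μ := κ)]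
        exact ENNReal.ofReal_le_one.2 hκ
    _ ≤ ε := by rwa [one_mul, mul_one]

/-! ### Calculus of `C¹` diffeomorphisms of the interval -/

namespace DiffPlus

lemma strictMono (f : DiffPlus) : StrictMono f.toHomeo := f.2.1

lemma isC1 (f : DiffPlus) : IsC1 f.toHomeo := f.2.2.1

lemma hasDerivWithinAt (f : DiffPlus) (s : I) :
    HasDerivWithinAt (extendReal f.toHomeo) (f.derivative s) (Icc 0 1) s :=
  (f.isC1.differentiableOn one_ne_zero s s.2).hasDerivWithinAt

lemma derivative_mul (f g : DiffPlus) (s : I) :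
    (f * g).derivative s = f.derivative (g.toHomeo s) * g.derivative s := by
  have h1 := f.hasDerivWithinAt (g.toHomeo s)
  rw [← extendReal_coe] at h1
  have h := (h1.comp (s : ℝ) (g.hasDerivWithinAt s) (mapsTo_extendReal _)).congr
    (f₁ := extendReal (f * g).toHomeo) (fun x hx => by
      rw [show x = ((⟨x, hx⟩ : I) : ℝ) from rfl, Function.comp_apply, extendReal_coe,
        extendReal_coe, extendReal_coe, map_mul]
      rfl) (by
      rw [Function.comp_apply, extendReal_coe, extendReal_coe, extendReal_coe, map_mul]
      rfl)
  exact h.derivWithin (uniqueDiffOn_Icc zero_lt_one _ s.2)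

lemma derivative_one (s : I) : (1 : DiffPlus).derivative s = 1 := by
  have h := (hasDerivWithinAt_id (s : ℝ) (Icc 0 1)).congr
    (f₁ := extendReal (1 : DiffPlus).toHomeo) (fun x hx => by
      rw [show x = ((⟨x, hx⟩ : I) : ℝ) from rfl, extendReal_coe, map_one]
      rfl) (by
      rw [extendReal_coe, map_one]
      rfl)
  exact h.derivWithin (uniqueDiffOn_Icc zero_lt_one _ s.2)

lemma derivative_pos (f : DiffPlus) (s : I) : 0 < f.derivative s := by
  have h0 : 0 ≤ f.derivative s := by
    refine MonotoneOn.derivWithin_nonneg (fun x hx y hy hxy => ?_)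
    rw [show x = ((⟨x, hx⟩ : I) : ℝ) from rfl, show y = ((⟨y, hy⟩ : I) : ℝ) from rfl,
      extendReal_coe, extendReal_coe]
    exact f.strictMono.monotone (a := ⟨x, hx⟩) (b := ⟨y, hy⟩) hxy
  refine h0.lt_of_ne' fun h => ?_
  have := derivative_mul f⁻¹ f s
  rw [inv_mul_cancel, derivative_one, h, mul_zero] at this
  exact one_ne_zero this

/-- The change of variables formula. -/
lemma lintegral_derivative_mul_comp (f : DiffPlus) (h : I → ℝ≥0∞) :
    ∫⁻ s, ENNReal.ofReal (f.derivative s) * h (f.toHomeo s) = ∫⁻ s, h s := by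
  have key := lintegral_image_eq_lintegral_abs_deriv_mul (f := extendReal f.toHomeo)
    (f' := fun x => f.derivative (projIcc 0 1 zero_le_one x)) (s := Icc (0 : ℝ) 1)
    measurableSet_Icc (fun x hx => by
      simpa only [projIcc_of_mem zero_le_one hx] using f.hasDerivWithinAt ⟨x, hx⟩)
    (fun x hx y hy hxy => by
      rw [show x = ((⟨x, hx⟩ : I) : ℝ) from rfl, show y = ((⟨y, hy⟩ : I) : ℝ) from rfl,
        extendReal_coe, extendReal_coe] at hxy
      exact congrArg Subtype.val (f.toHomeo.injective (Subtype.ext hxy)))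
    (fun x => h (projIcc 0 1 zero_le_one x))
  have himage : extendReal f.toHomeo '' Icc 0 1 = Icc 0 1 := by
    refine (mapsTo_extendReal _).image_subset.antisymm fun y hy => ?_
    refine ⟨f.toHomeo.symm ⟨y, hy⟩, (f.toHomeo.symm ⟨y, hy⟩).2, ?_⟩
    rw [extendReal_coe, f.toHomeo.apply_symm_apply]
  have hI : ∀ F : ℝ → ℝ≥0∞, ∫⁻ x in Icc (0 : ℝ) 1, F x = ∫⁻ s : I, F s := fun F =>
    (unitInterval.measurePreserving_coe.lintegral_comp_emb
      unitInterval.measurableEmbedding_coe F).symm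
  rw [himage, hI, hI] at key
  simp only [projIcc_val, extendReal_coe] at key
  rw [key]
  simp only [abs_of_pos (f.derivative_pos _)]

lemma exists_derivative_bounds (f : DiffPlus) :
    ∃ c C : ℝ, 0 < c ∧ c ≤ 1 ∧ 1 ≤ C ∧ ∀ s, c ≤ f.derivative s ∧ f.derivative s ≤ C := by
  obtain ⟨a, -, ha⟩ := isCompact_univ.exists_isMinOn univ_nonempty
    f.derivative.continuous.continuousOn
  obtain ⟨b, -, hb⟩ := isCompact_univ.exists_isMaxOn univ_nonempty
    f.derivative.continuous.continuousOn
  exact ⟨min (f.derivative a) 1, max (f.derivative b) 1, lt_min (f.derivative_pos a) one_pos,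
    min_le_right _ _, le_max_right _ _, fun s => ⟨(min_le_left _ _).trans (ha (mem_univ s)),
      (hb (mem_univ s)).trans (le_max_left _ _)⟩⟩

lemma integrable_derivative (f : DiffPlus) (κ : Measure I) [IsFiniteMeasure κ] :
    Integrable f.derivative κ := by
  obtain ⟨c, C, hc, -, -, h⟩ := f.exists_derivative_bounds
  exact Integrable.of_bound f.derivative.continuous.measurable.aestronglyMeasurable C
    (Eventually.of_forall fun s => by
      rw [Real.norm_of_nonneg (f.derivative_pos s).le]
      exact (h s).2)

/-- If `f` carries `Z` to `Z'` up to null sets, then it carries the measure with density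
`f.derivative` on `Z` to Lebesgue measure on `Z'`. -/
lemma restrict_real_Iic (f : DiffPlus) {Z Z' : Set I} (hZ : MeasurableSet Z)
    (hZ' : MeasurableSet Z') (h : ∀ᵐ s : I, s ∈ Z ↔ f.toHomeo s ∈ Z') (s : I) :
    (volume.restrict Z').real (Iic (f.toHomeo s))
      = ∫ x in Iic s, f.derivative x ∂(volume.restrict Z) := by
  rw [integral_eq_lintegral_of_nonneg_ae (Eventually.of_forall fun x => (f.derivative_pos x).le)
    f.derivative.continuous.measurable.aestronglyMeasurable, measureReal_def]
  congr 1
  rw [Measure.restrict_restrict measurableSet_Iic, Measure.restrict_apply measurableSet_Iic,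
    ← lintegral_indicator (measurableSet_Iic.inter hZ),
    ← lintegral_indicator_one (measurableSet_Iic.inter hZ'), ← f.lintegral_derivative_mul_comp]
  refine lintegral_congr_ae ?_
  filter_upwards [h] with x hx
  by_cases h1 : x ∈ Iic s ∩ Z
  · have h2 : f.toHomeo x ∈ Iic (f.toHomeo s) ∩ Z' := ⟨f.strictMono.monotone h1.1, hx.1 h1.2⟩
    simp [indicator_of_mem h1, indicator_of_mem h2]
  · have h2 : f.toHomeo x ∉ Iic (f.toHomeo s) ∩ Z' :=
      fun h2 => h1 ⟨f.strictMono.le_iff_le.1 h2.1, hx.2 h2.2⟩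
    simp [indicator_of_notMem h1, indicator_of_notMem h2]

/-- Averages of `f.derivative` over `[0, s]` with respect to a diffuse measure `κ` are asymptotic
to the value of `f.derivative` at `s`, as `s` decreases to the left end of the support of `κ`.
This is where continuity of the derivative enters. -/
lemma abs_derivative_mul_sub_integral_le (f : DiffPlus) (κ : Measure I) [IsFiniteMeasure κ]
    [NullSingletonClass κ] {η : ℝ} (hη : 0 < η) :
    ∃ τ > 0, ∀ s, 0 < κ.real (Iic s) → κ.real (Iic s) < τ →
      |f.derivative s * κ.real (Iic s) - ∫ x in Iic s, f.derivative x ∂κ|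
        ≤ η * κ.real (Iic s) := by
  have hc := continuous_real_Iic κ
  -- `a` is the left end of the support of `κ`
  obtain ⟨a, ha, hmax⟩ := (isClosed_Iic.preimage hc).isCompact.exists_isGreatest
    (s := (fun s => κ.real (Iic s)) ⁻¹' Iic 0) ⟨0, by simp [real_Iic_zero]⟩
  have ha : κ.real (Iic a) = 0 := le_antisymm ha measureReal_nonneg
  have hlt : ∀ s, 0 < κ.real (Iic s) → a < s := fun s hs => by
    by_contra! hsa
    exact hs.not_ge ((monotone_real_Iic κ hsa).trans ha.le)
  obtain ⟨ρ, hρ, hρη⟩ := Metric.continuousAt_iff.1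
    (f.derivative.continuous.continuousAt (x := a)) (η / 2) (half_pos hη)
  obtain ⟨τ, hτ, hτρ⟩ : ∃ τ > 0, ∀ s, κ.real (Iic s) < τ → (s : ℝ) < a + ρ := by
    by_cases h1 : (a : ℝ) + ρ / 2 ≤ 1
    · let b : I := ⟨a + ρ / 2, by have := a.2.1; positivity, h1⟩
      have hab : a < b := by
        rw [← Subtype.coe_lt_coe]
        change (a : ℝ) < a + ρ / 2
        linarith
      refine ⟨κ.real (Iic b), ?_, fun s hs => ?_⟩
      · by_contra! h
        exact hab.not_ge (hmax h)
      · have : s < b := by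
          by_contra! h
          exact hs.not_ge (monotone_real_Iic κ h)
        have : (s : ℝ) < a + ρ / 2 := this
        linarith
    · exact ⟨1, one_pos, fun s _ => by linarith [s.2.2]⟩
  refine ⟨τ, hτ, fun s hs hsτ => ?_⟩
  have hsa := hlt s hs
  have hsρ := hτρ s hsτ
  have hnear : ∀ x, a < x → x ≤ s → |f.derivative x - f.derivative a| < η / 2 := fun x hx hxs => by
    have h1 : (a : ℝ) < x := hx
    have h2 : (x : ℝ) ≤ s := hxs
    refine hρη ?_
    rw [Subtype.dist_eq, Real.dist_eq, abs_lt]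
    constructor <;> linarith
  have hae : ∀ᵐ x ∂κ, a < x := by
    rw [ae_iff]
    have : {x | ¬ a < x} = Iic a := by
      ext x
      simp
    rw [this]
    exact (measureReal_eq_zero_iff (measure_ne_top _ _)).1 ha
  have hint : f.derivative s * κ.real (Iic s) - ∫ x in Iic s, f.derivative x ∂κ
      = ∫ x in Iic s, (f.derivative s - f.derivative x) ∂κ := by
    rw [integral_sub (μ := κ.restrict (Iic s)) (integrable_const _)
      (f.integrable_derivative (κ.restrict (Iic s))), setIntegral_const, smul_eq_mul, mul_comm]
  rw [hint, ← Real.norm_eq_abs]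
  refine norm_setIntegral_le_of_norm_le_const_ae' (measure_lt_top κ (Iic s)) ?_
  filter_upwards [hae] with x hx hxs
  rw [Real.norm_eq_abs, ← sub_sub_sub_cancel_right _ _ (f.derivative a)]
  refine (abs_sub _ _).trans ?_
  linarith [hnear x hx hxs, hnear s hsa le_rfl]

end DiffPlus

/-! ### Almost invariance on the fibres -/

lemma sqrt_sub_sqrt_sq_le {x y : ℝ} (hx : 0 ≤ x) (hy : 0 ≤ y) : (√x - √y) ^ 2 ≤ |x - y| := by
  have h1 := Real.sqrt_nonneg x
  have h2 := Real.sqrt_nonneg y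
  have e : |x - y| = |√x - √y| * (√x + √y) := by
    rw [show x - y = (√x - √y) * (√x + √y) from ?_, abs_mul, abs_of_nonneg (add_nonneg h1 h2)]
    nlinarith [Real.sq_sqrt hx, Real.sq_sqrt hy]
  rw [e, ← sq_abs, sq]
  gcongr
  rw [abs_le]
  constructor <;> linarith

/-- The pointwise comparison behind almost invariance: if `r = t' / t`, then
`d * k(t') / k(t) = (d / r) * r ^ θ` for the density `k t = θ * t ^ (θ - 1)`. -/
lemma abs_mul_powerDensity_sub_le (n : ℕ) {c C d t t' : ℝ} (hc : 0 < c) (hC1 : 1 ≤ C)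
    (ht : 0 < t) (h1 : c * t ≤ t') (h2 : t' ≤ C * t) :
    |d * powerDensity n t' - powerDensity n t| ≤
      powerDensity n t * (C * (c⁻¹ * (|d * t - t'| / t)))
        + powerDensity n t * max (C ^ (1 / (n + 1 : ℝ)) - 1) (1 - c ^ (1 / (n + 1 : ℝ))) := by
  have hθ : (0 : ℝ) < 1 / (n + 1 : ℝ) := by positivity
  have hθ1 : 1 / (n + 1 : ℝ) ≤ 1 := by
    rw [div_le_one (by positivity)]
    simp
  set θ : ℝ := 1 / (n + 1 : ℝ) with hθ_def
  have ht' : 0 < t' := (mul_pos hc ht).trans_le h1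
  obtain ⟨r, hr, rfl⟩ : ∃ r, 0 < r ∧ t' = r * t := ⟨t' / t, by positivity, by field_simp⟩
  have hcr : c ≤ r := le_of_mul_le_mul_right h1 ht
  have hrC : r ≤ C := le_of_mul_le_mul_right h2 ht
  have hrθ : r ^ θ ≤ C := (Real.rpow_le_rpow hr.le hrC hθ.le).trans
    (by simpa using Real.rpow_le_rpow_of_exponent_le hC1 hθ1)
  have e1 : d * powerDensity n (r * t) - powerDensity n t
      = powerDensity n t * ((d - r) / r * r ^ θ + (r ^ θ - 1)) := by
    have : powerDensity n (r * t) = powerDensity n t * (r ^ θ / r) := by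
      unfold powerDensity
      rw [← hθ_def, Real.mul_rpow hr.le ht.le, Real.rpow_sub_one hr.ne']
      ring
    rw [this]
    field_simp
    ring
  have hk := powerDensity_nonneg n ht.le
  rw [e1, abs_mul, abs_of_nonneg hk, ← mul_add]
  refine mul_le_mul_of_nonneg_left ((abs_add_le _ _).trans (add_le_add ?_ ?_)) hk
  · have e2 : |d * t - r * t| / t = |d - r| := by
      rw [← sub_mul, abs_mul, abs_of_pos ht, mul_div_assoc, div_self ht.ne', mul_one]
    rw [e2, abs_mul, abs_div, abs_of_pos hr, abs_of_pos (Real.rpow_pos_of_pos hr θ), mul_comm C,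
      div_eq_inv_mul]
    gcongr
  · rw [abs_le]
    have h3 : c ^ θ ≤ r ^ θ := Real.rpow_le_rpow hc.le hcr hθ.le
    have h4 : r ^ θ ≤ C ^ θ := Real.rpow_le_rpow hr.le hrC hθ.le
    constructor
    · linarith [le_max_right (C ^ θ - 1) (1 - c ^ θ)]
    · linarith [le_max_left (C ^ θ - 1) (1 - c ^ θ)]

/-- The density `powerDensity n` in the coordinate `s ↦ λ(Z ∩ [0, s])`, supported in `Z`. -/
def fiberDensity (Z : Set I) (n : ℕ) : I → ℝ :=
  Z.indicator fun s => powerDensity n ((volume.restrict Z).real (Iic s))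

lemma fiberDensity_nonneg (Z : Set I) (n : ℕ) (s : I) : 0 ≤ fiberDensity Z n s :=
  indicator_nonneg (fun _ _ => powerDensity_nonneg n measureReal_nonneg) s

lemma measurable_fiberDensity {Z : Set I} (hZ : MeasurableSet Z) (n : ℕ) :
    Measurable (fiberDensity Z n) :=
  ((measurable_powerDensity n).comp (monotone_real_Iic _).measurable).indicator hZ

lemma lintegral_fiberDensity {Z : Set I} (hZ : MeasurableSet Z) (n : ℕ) :
    ∫⁻ s, ENNReal.ofReal (fiberDensity Z n s)
      = ENNReal.ofReal (volume.real Z ^ (1 / (n + 1 : ℝ))) := by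
  have e : (fun s => ENNReal.ofReal (fiberDensity Z n s)) = Z.indicator
      fun s => ENNReal.ofReal (powerDensity n ((volume.restrict Z).real (Iic s))) :=
    (indicator_comp_of_zero ENNReal.ofReal_zero).symm
  rw [e, lintegral_indicator hZ, lintegral_powerDensity_real_Iic, measureReal_restrict_apply_univ]

lemma lintegral_fiberDensity_le_one {Z : Set I} (hZ : MeasurableSet Z) (n : ℕ) :
    ∫⁻ s, ENNReal.ofReal (fiberDensity Z n s) ≤ 1 := by
  rw [lintegral_fiberDensity hZ]
  exact ENNReal.ofReal_le_one.2
    (Real.rpow_le_one measureReal_nonneg measureReal_le_one (by positivity))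

lemma le_lintegral_fiberDensity {Z : Set I} (hZ : MeasurableSet Z) (n : ℕ) :
    volume Z ≤ ∫⁻ s, ENNReal.ofReal (fiberDensity Z n s) := by
  rw [lintegral_fiberDensity hZ, ← ofReal_measureReal (μ := volume)]
  refine ENNReal.ofReal_le_ofReal ?_
  rcases measureReal_nonneg.eq_or_lt' (a := volume.real Z) with h | h
  · rw [h]
    positivity
  · refine Real.self_le_rpow_of_le_one h.le measureReal_le_one ?_
    rw [div_le_one (by positivity)]
    simp

lemma lintegral_abs_fiberDensity_le_two (f : DiffPlus) {Z Z' : Set I} (hZ : MeasurableSet Z)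
    (hZ' : MeasurableSet Z') (n : ℕ) :
    ∫⁻ s, ENNReal.ofReal
      |f.derivative s * fiberDensity Z' n (f.toHomeo s) - fiberDensity Z n s| ≤ 2 := by
  calc _ ≤ ∫⁻ s, (ENNReal.ofReal (f.derivative s) *
            ENNReal.ofReal (fiberDensity Z' n (f.toHomeo s))
          + ENNReal.ofReal (fiberDensity Z n s)) := by
        refine lintegral_mono fun s => ?_
        have h0 := f.derivative_pos s
        have h1 := fiberDensity_nonneg Z' n (f.toHomeo s)
        have h2 := fiberDensity_nonneg Z n s
        rw [← ENNReal.ofReal_mul h0.le, ← ENNReal.ofReal_add (mul_nonneg h0.le h1) h2]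
        refine ENNReal.ofReal_le_ofReal ((abs_sub _ _).trans_eq ?_)
        rw [abs_of_nonneg (mul_nonneg h0.le h1), abs_of_nonneg h2]
    _ = (∫⁻ s, ENNReal.ofReal (fiberDensity Z' n s))
        + ∫⁻ s, ENNReal.ofReal (fiberDensity Z n s) := by
        rw [lintegral_add_right _ (measurable_fiberDensity hZ n).ennreal_ofReal,
          f.lintegral_derivative_mul_comp fun s => ENNReal.ofReal (fiberDensity Z' n s)]
    _ ≤ 1 + 1 := add_le_add (lintegral_fiberDensity_le_one hZ' n)
        (lintegral_fiberDensity_le_one hZ n)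
    _ = 2 := one_add_one_eq_two

/-- A `C¹` diffeomorphism that carries `Z` to `Z'` carries the densities `fiberDensity Z n`
asymptotically to the densities `fiberDensity Z' n`. -/
lemma tendsto_lintegral_fiberDensity (f : DiffPlus) {Z Z' : Set I} (hZ : MeasurableSet Z)
    (hZ' : MeasurableSet Z') (h : ∀ᵐ s : I, s ∈ Z ↔ f.toHomeo s ∈ Z') :
    Tendsto (fun n => ∫⁻ s, ENNReal.ofReal
      |f.derivative s * fiberDensity Z' n (f.toHomeo s) - fiberDensity Z n s|) atTop (𝓝 0) := by
  obtain ⟨c, C, hc, hc1, hC1, hcC⟩ := f.exists_derivative_bounds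
  set κ : Measure I := volume.restrict Z with hκ_def
  have hκ1 : κ.real univ ≤ 1 := by
    rw [hκ_def, measureReal_restrict_apply_univ]
    exact measureReal_le_one
  let T : I → ℝ := fun s => ∫ x in Iic s, f.derivative x ∂κ
  have hT1 : ∀ s, c * κ.real (Iic s) ≤ T s := fun s => by
    have := setIntegral_mono (μ := κ) (s := Iic s) (integrable_const c).integrableOn
      (f.integrable_derivative κ).integrableOn fun x => (hcC x).1
    rwa [setIntegral_const, smul_eq_mul, mul_comm] at this
  have hT2 : ∀ s, T s ≤ C * κ.real (Iic s) := fun s => by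
    have := setIntegral_mono (μ := κ) (s := Iic s) (f.integrable_derivative κ).integrableOn
      (integrable_const C).integrableOn fun x => (hcC x).2
    rwa [setIntegral_const, smul_eq_mul, mul_comm _ C] at this
  let R : I → ℝ := fun s =>
    C * (c⁻¹ * (|f.derivative s * κ.real (Iic s) - T s| / κ.real (Iic s)))
  let e : ℕ → ℝ := fun n => max (C ^ (1 / (n + 1 : ℝ)) - 1) (1 - c ^ (1 / (n + 1 : ℝ)))
  have he : Tendsto e atTop (𝓝 0) := by
    have hθ := tendsto_one_div_add_atTop_nhds_zero_nat (𝕜 := ℝ)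
    have h1 := ((tendsto_const_nhds (x := C)).rpow hθ (Or.inl (by positivity))).sub_const 1
    have h2 := ((tendsto_const_nhds (x := c)).rpow hθ (Or.inl hc.ne')).const_sub 1
    simpa [e] using h1.max h2
  have hR := tendsto_lintegral_powerDensity_mul κ hκ1 (h := R) (B := C * (c⁻¹ * (2 * C)))
    (by
      filter_upwards [ae_real_Iic_pos κ] with s hs
      refine mul_le_mul_of_nonneg_left (mul_le_mul_of_nonneg_left ?_ (by positivity))
        (by positivity)
      rw [div_le_iff₀ hs]
      refine (abs_sub _ _).trans ?_
      rw [abs_of_nonneg (mul_nonneg (f.derivative_pos s).le hs.le),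
        abs_of_nonneg ((mul_pos hc hs).le.trans (hT1 s))]
      nlinarith [hT2 s, (hcC s).2])
    (by
      intro η hη
      obtain ⟨τ, hτ, H⟩ := f.abs_derivative_mul_sub_integral_le κ
        (η := η * c / C) (by positivity)
      refine ⟨τ, hτ, fun s hs hsτ => ?_⟩
      calc R s ≤ C * (c⁻¹ * (η * c / C)) := by
            refine mul_le_mul_of_nonneg_left (mul_le_mul_of_nonneg_left ?_ (by positivity))
              (by positivity)
            rw [div_le_iff₀ hs]
            exact H s hs hsτ
        _ = η := by field_simp)
  have hlim := hR.add ((ENNReal.tendsto_ofReal he))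
  rw [ENNReal.ofReal_zero, add_zero] at hlim
  refine tendsto_of_tendsto_of_tendsto_of_le_of_le tendsto_const_nhds hlim (fun _ => zero_le)
    fun n => ?_
  have hbound : ∀ᵐ s : I, ENNReal.ofReal
      |f.derivative s * fiberDensity Z' n (f.toHomeo s) - fiberDensity Z n s| ≤
      Z.indicator (fun s => ENNReal.ofReal (powerDensity n (κ.real (Iic s))) * ENNReal.ofReal (R s)
        + ENNReal.ofReal (powerDensity n (κ.real (Iic s))) * ENNReal.ofReal (e n)) s := by
    filter_upwards [h, (ae_restrict_iff' hZ).1 (ae_real_Iic_pos κ)] with s hs hpos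
    by_cases hsZ : s ∈ Z
    · have hpos := hpos hsZ
      rw [fiberDensity, fiberDensity, indicator_of_mem hsZ, indicator_of_mem (hs.1 hsZ),
        indicator_of_mem hsZ, f.restrict_real_Iic hZ hZ' h,
        ← ENNReal.ofReal_mul (powerDensity_nonneg n hpos.le),
        ← ENNReal.ofReal_mul (powerDensity_nonneg n hpos.le), ← ENNReal.ofReal_add]
      · exact ENNReal.ofReal_le_ofReal
          (abs_mul_powerDensity_sub_le n hc hC1 hpos (hT1 s) (hT2 s))
      · exact mul_nonneg (powerDensity_nonneg n hpos.le) (by positivity)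
      · refine mul_nonneg (powerDensity_nonneg n hpos.le) (le_max_of_le_right ?_)
        exact sub_nonneg.2 (Real.rpow_le_one hc.le hc1 (by positivity))
    · have hsZ' : f.toHomeo s ∉ Z' := fun h' => hsZ (hs.2 h')
      simp [fiberDensity, hsZ, hsZ']
  calc _ ≤ ∫⁻ s, (ENNReal.ofReal (powerDensity n (κ.real (Iic s))) * ENNReal.ofReal (R s)
        + ENNReal.ofReal (powerDensity n (κ.real (Iic s))) * ENNReal.ofReal (e n)) ∂κ := by
        rw [← lintegral_indicator hZ]
        exact lintegral_mono_ae hbound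
    _ = (∫⁻ s, ENNReal.ofReal (powerDensity n (κ.real (Iic s))) * ENNReal.ofReal (R s) ∂κ)
        + ENNReal.ofReal (κ.real univ ^ (1 / (n + 1 : ℝ))) * ENNReal.ofReal (e n) := by
      rw [lintegral_add_right _ ((measurable_powerDensity_real_Iic κ n).mul_const _),
        lintegral_mul_const' _ _ ENNReal.ofReal_ne_top, lintegral_powerDensity_real_Iic]
    _ ≤ _ := by
      refine add_le_add_right (mul_le_of_le_one_left' ?_) _
      exact ENNReal.ofReal_le_one.2 (Real.rpow_le_one measureReal_nonneg hκ1 (by positivity))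

/-! ### Square-integrable functions -/

section L2

variable {X : Type*} [MeasurableSpace X] {P : Measure X}

lemma eLpNorm_two_sq (f : X → ℂ) : eLpNorm f 2 P ^ 2 = ∫⁻ x, ‖f x‖ₑ ^ 2 ∂P := by
  have h := eLpNorm_nnreal_pow_eq_lintegral (f := f) (μ := P) (p := 2) two_ne_zero
  simpa only [NNReal.coe_ofNat, ENNReal.rpow_ofNat, ENNReal.coe_ofNat] using h

lemma enorm_sq_eq_lintegral (f : Lp ℂ 2 P) : ‖f‖ₑ ^ 2 = ∫⁻ x, ‖f x‖ₑ ^ 2 ∂P := by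
  rw [Lp.enorm_def, eLpNorm_two_sq]

lemma setLIntegral_enorm_sq_le {v w : Lp ℂ 2 P} {Z : Set X} (hZ : MeasurableSet Z)
    (hw : ∀ᵐ x ∂P, x ∈ Z → w x = 0) : ∫⁻ x in Z, ‖v x‖ₑ ^ 2 ∂P ≤ ‖v - w‖ₑ ^ 2 := by
  rw [enorm_sq_eq_lintegral]
  refine le_trans (le_of_eq (setLIntegral_congr_fun_ae hZ ?_)) (setLIntegral_le_lintegral Z _)
  filter_upwards [hw, Lp.coeFn_sub v w] with x hx hsub hxZ
  rw [hsub, Pi.sub_apply, hx hxZ, sub_zero]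

end L2

/-! ### Koopman representations of nonsingular actions -/

/-- A nonsingular action of `G` on a measure space `(X, P)`, defined up to null sets for each
group element: the transformations `act g`, together with strictly positive versions `jac g` of the
Radon–Nikodym derivatives of `P` transported by `(act g)⁻¹` with respect to `P`. -/
structure NonsingularAction (G : Type*) [Group G] [MeasurableSpace G] {X : Type*}
    [MeasurableSpace X] (P : Measure X) where
  /-- The transformation of `X` by an element of `G`. -/
  act : G → X → X
  /-- The Jacobian of the transformation. -/
  jac : G → X → ℝ
  measurable_act : Measurable (Function.uncurry act)
  measurable_jac : Measurable (Function.uncurry jac)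
  jac_pos : ∀ g x, 0 < jac g x
  lintegral_jac_mul : ∀ g (F : X → ℝ≥0∞), Measurable F →
    ∫⁻ x, ENNReal.ofReal (jac g x) * F (act g x) ∂P = ∫⁻ x, F x ∂P
  act_one : ∀ᵐ x ∂P, act 1 x = x
  act_mul : ∀ g h, ∀ᵐ x ∂P, act (g * h) x = act g (act h x)
  jac_one : ∀ᵐ x ∂P, jac 1 x = 1
  jac_mul : ∀ g h, ∀ᵐ x ∂P, jac (g * h) x = jac g (act h x) * jac h x

namespace NonsingularAction

variable {G : Type u} [Group G] [MeasurableSpace G] {X : Type v} [MeasurableSpace X]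
  {P : Measure X} (A : NonsingularAction G P)

include A

lemma measurable_act_left (g : G) : Measurable (A.act g) :=
  A.measurable_act.comp measurable_prodMk_left

lemma measurable_jac_left (g : G) : Measurable (A.jac g) :=
  A.measurable_jac.comp measurable_prodMk_left

lemma quasiMeasurePreserving (g : G) : Measure.QuasiMeasurePreserving (A.act g) P P := by
  refine ⟨A.measurable_act_left g, Measure.AbsolutelyContinuous.mk fun N hN h => ?_⟩
  rw [Measure.map_apply (A.measurable_act_left g) hN]
  have h1 := A.lintegral_jac_mul g (N.indicator 1) (measurable_one.indicator hN)
  rw [lintegral_indicator_one hN, h, lintegral_eq_zero_iff' (by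
    exact ((A.measurable_jac_left g).ennreal_ofReal.mul
      ((measurable_one.indicator hN).comp (A.measurable_act_left g))).aemeasurable)] at h1
  refine measure_mono_null (fun x hx => ?_) h1
  have h2 : N.indicator (1 : X → ℝ≥0∞) (A.act g x) = 1 := indicator_of_mem (mem_preimage.1 hx) _
  have h3 : 0 < ENNReal.ofReal (A.jac g x) := ENNReal.ofReal_pos.2 (A.jac_pos g x)
  change ¬ (ENNReal.ofReal (A.jac g x) * N.indicator (1 : X → ℝ≥0∞) (A.act g x) = 0)
  rw [h2, mul_one]
  exact h3.ne'

/-- The Koopman operator of `g` on functions, normalised to preserve the norm of `L²`. -/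
def koopmanFun (g : G) (f : X → ℂ) (x : X) : ℂ := (√(A.jac g⁻¹ x) : ℝ) * f (A.act g⁻¹ x)

lemma koopmanFun_congr (g : G) {f f' : X → ℂ} (h : f =ᵐ[P] f') :
    A.koopmanFun g f =ᵐ[P] A.koopmanFun g f' := by
  filter_upwards [(A.quasiMeasurePreserving g⁻¹).ae_eq_comp h] with x hx
  rw [koopmanFun, koopmanFun, show f (A.act g⁻¹ x) = f' (A.act g⁻¹ x) from hx]

lemma measurable_koopmanFun (g : G) {f : X → ℂ} (h : Measurable f) :
    Measurable (A.koopmanFun g f) :=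
  (Complex.measurable_ofReal.comp (A.measurable_jac_left _).sqrt).mul
    (h.comp (A.measurable_act_left _))

lemma enorm_koopmanFun_sq (g : G) (f : X → ℂ) (x : X) :
    ‖A.koopmanFun g f x‖ₑ ^ 2 = ENNReal.ofReal (A.jac g⁻¹ x) * ‖f (A.act g⁻¹ x)‖ₑ ^ 2 := by
  rw [koopmanFun, enorm_mul, mul_pow]
  congr 1
  rw [← ofReal_norm, Complex.norm_real, Real.norm_of_nonneg (Real.sqrt_nonneg _),
    ← ENNReal.ofReal_pow (Real.sqrt_nonneg _), Real.sq_sqrt (A.jac_pos _ _).le]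

lemma eLpNorm_koopmanFun (g : G) {f : X → ℂ} (h : Measurable f) :
    eLpNorm (A.koopmanFun g f) 2 P = eLpNorm f 2 P := by
  refine ENNReal.rpow_left_injective two_ne_zero ?_
  change eLpNorm (A.koopmanFun g f) 2 P ^ (2 : ℝ) = eLpNorm f 2 P ^ (2 : ℝ)
  rw [ENNReal.rpow_two, ENNReal.rpow_two, eLpNorm_two_sq, eLpNorm_two_sq,
    ← A.lintegral_jac_mul g⁻¹ (fun x => ‖f x‖ₑ ^ 2) (h.enorm.pow_const 2)]
  exact lintegral_congr fun x => A.enorm_koopmanFun_sq g f x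

lemma memLp_koopmanFun (g : G) (f : Lp ℂ 2 P) : MemLp (A.koopmanFun g f) 2 P :=
  ⟨(A.measurable_koopmanFun g (Lp.stronglyMeasurable f).measurable).aestronglyMeasurable, by
    rw [A.eLpNorm_koopmanFun g (Lp.stronglyMeasurable f).measurable]
    exact Lp.eLpNorm_lt_top f⟩

/-- The Koopman operator as an isometry of `L²`. -/
def koopmanIsometry (g : G) : Lp ℂ 2 P →ₗᵢ[ℂ] Lp ℂ 2 P where
  toFun f := (A.memLp_koopmanFun g f).toLp _
  map_add' f f' := by
    refine Lp.ext ?_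
    filter_upwards [(A.memLp_koopmanFun g (f + f')).coeFn_toLp,
      (A.memLp_koopmanFun g f).coeFn_toLp, (A.memLp_koopmanFun g f').coeFn_toLp,
      Lp.coeFn_add ((A.memLp_koopmanFun g f).toLp _) ((A.memLp_koopmanFun g f').toLp _),
      A.koopmanFun_congr g (Lp.coeFn_add f f')] with x h1 h2 h3 h4 h5
    rw [h1, h4, Pi.add_apply, h2, h3, h5]
    simp only [koopmanFun, Pi.add_apply, mul_add]
  map_smul' c f := by
    refine Lp.ext ?_
    filter_upwards [(A.memLp_koopmanFun g (c • f)).coeFn_toLp,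
      (A.memLp_koopmanFun g f).coeFn_toLp, Lp.coeFn_smul c ((A.memLp_koopmanFun g f).toLp _),
      A.koopmanFun_congr g (Lp.coeFn_smul c f)] with x h1 h2 h3 h4
    rw [h1, RingHom.id_apply, h3, Pi.smul_apply, h2, h4]
    simp only [koopmanFun, Pi.smul_apply, smul_eq_mul, mul_left_comm]
  norm_map' f := by
    change ‖(A.memLp_koopmanFun g f).toLp _‖ = ‖f‖
    rw [Lp.norm_toLp, A.eLpNorm_koopmanFun g (Lp.stronglyMeasurable f).measurable, Lp.norm_def]

lemma koopmanIsometry_ae_eq (g : G) (f : Lp ℂ 2 P) :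
    A.koopmanIsometry g f =ᵐ[P] A.koopmanFun g f :=
  (A.memLp_koopmanFun g f).coeFn_toLp

lemma koopmanIsometry_one (f : Lp ℂ 2 P) : A.koopmanIsometry 1 f = f := by
  refine Lp.ext ?_
  filter_upwards [A.koopmanIsometry_ae_eq 1 f, A.act_one, A.jac_one] with x h1 h2 h3
  rw [h1, koopmanFun, inv_one, h2, h3]
  simp

lemma koopmanIsometry_mul (g h : G) (f : Lp ℂ 2 P) :
    A.koopmanIsometry (g * h) f = A.koopmanIsometry g (A.koopmanIsometry h f) := by
  refine Lp.ext ?_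
  filter_upwards [A.koopmanIsometry_ae_eq (g * h) f,
    A.koopmanIsometry_ae_eq g (A.koopmanIsometry h f),
    A.koopmanFun_congr g (A.koopmanIsometry_ae_eq h f), A.act_mul h⁻¹ g⁻¹, A.jac_mul h⁻¹ g⁻¹]
    with x h1 h2 h3 h4 h5
  rw [h1, h2, h3, koopmanFun, koopmanFun, koopmanFun, mul_inv_rev, h4, h5,
    Real.sqrt_mul (A.jac_pos _ _).le]
  push_cast
  ring

/-- The Koopman representation of `G` on `L²(X, P)`. -/
def koopman : G →* (Lp ℂ 2 P ≃ₗᵢ[ℂ] Lp ℂ 2 P) where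
  toFun g :=
    LinearIsometryEquiv.ofLinearIsometry (A.koopmanIsometry g)
        (A.koopmanIsometry g⁻¹).toLinearMap
        (by
          ext1 f
          change A.koopmanIsometry g (A.koopmanIsometry g⁻¹ f) = f
          rw [← koopmanIsometry_mul, mul_inv_cancel, koopmanIsometry_one])
        (by
          ext1 f
          change A.koopmanIsometry g⁻¹ (A.koopmanIsometry g f) = f
          rw [← koopmanIsometry_mul, inv_mul_cancel, koopmanIsometry_one])
  map_one' := by
    ext1 f
    exact A.koopmanIsometry_one f
  map_mul' g h := by
    ext1 f
    exact A.koopmanIsometry_mul g h f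

lemma koopman_ae_eq (g : G) (f : Lp ℂ 2 P) : A.koopman g f =ᵐ[P] A.koopmanFun g f :=
  A.koopmanIsometry_ae_eq g f

lemma measurable_inner_koopman [SFinite P] [MeasurableInv G] (v w : Lp ℂ 2 P) :
    Measurable fun g => inner ℂ w (A.koopman g v) := by
  have hm : Measurable (Function.uncurry fun (g : G) (x : X) =>
      inner ℂ (w x) (A.koopmanFun g v x)) := by
    have hinv : Measurable fun p : G × X => (p.1⁻¹, p.2) := by fun_prop
    have h1 := A.measurable_act.comp hinv
    have h2 := A.measurable_jac.comp hinv
    have hv := (Lp.stronglyMeasurable v).measurable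
    have hw := (Lp.stronglyMeasurable w).measurable
    exact (hw.comp measurable_snd).inner
      ((Complex.measurable_ofReal.comp h2.sqrt).mul (hv.comp h1))
  have h := (hm.stronglyMeasurable.integral_prod_right (ν := P)).measurable
  convert h using 2 with g
  rw [L2.inner_def]
  refine integral_congr_ae ?_
  filter_upwards [A.koopman_ae_eq g v] with x hx
  rw [hx]

lemma continuous_koopman [TopologicalSpace G] [IsTopologicalGroup G] [T2Space G]
    [LocallyCompactSpace G] [BorelSpace G] [SFinite P] [MeasurableSpace.CountablyGenerated X]
    (v : Lp ℂ 2 P) : Continuous fun g => A.koopman g v := by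
  have : Fact ((2 : ℝ≥0∞) ≠ ⊤) := ⟨ENNReal.ofNat_ne_top⟩
  exact continuous_of_measurable_inner A.koopman A.measurable_inner_koopman v

/-- The squares of the invariant vectors in a dense sequence add up to an invariant density, up to
weights. Each invariant vector vanishes where this density does. -/
lemma exists_invariant_density [SFinite P] [MeasurableSpace.CountablyGenerated X] :
    ∃ d : X → ℝ≥0∞, Measurable d ∧ ∫⁻ x, d x ∂P ≠ ⊤ ∧
      (∀ g, ∀ᵐ x ∂P, d x = ENNReal.ofReal (A.jac g x) * d (A.act g x)) ∧
      ∀ w : Lp ℂ 2 P, (∀ g, A.koopman g w = w) → ∀ᵐ x ∂P, d x = 0 → w x = 0 := by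
  have : Fact ((2 : ℝ≥0∞) ≠ ⊤) := ⟨ENNReal.ofNat_ne_top⟩
  let W : Set (Lp ℂ 2 P) := {w | ∀ g, A.koopman g w = w}
  have : Nonempty W := ⟨0, fun g => map_zero _⟩
  let w : ℕ → W := TopologicalSpace.denseSeq W
  obtain ⟨a, ha, hsum⟩ := ENNReal.exists_pos_tsum_mul_lt_of_countable one_ne_zero
    (fun n => ‖(w n : Lp ℂ 2 P)‖ₑ ^ 2) fun n => ENNReal.pow_ne_top enorm_ne_top
  have hmeas : ∀ n, Measurable fun x => ‖(w n : Lp ℂ 2 P) x‖ₑ ^ 2 * (a n : ℝ≥0∞) := fun n =>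
    ((Lp.stronglyMeasurable _).measurable.enorm.pow_const 2).mul_const _
  refine ⟨fun x => ∑' n, ‖(w n : Lp ℂ 2 P) x‖ₑ ^ 2 * (a n : ℝ≥0∞), Measurable.tsum hmeas,
    ?_, fun g => ?_, fun v hv => ?_⟩
  · rw [lintegral_tsum fun n => (hmeas n).aemeasurable]
    refine ne_top_of_lt (lt_of_eq_of_lt (tsum_congr fun n => ?_) hsum)
    rw [lintegral_mul_const' _ _ ENNReal.coe_ne_top, enorm_sq_eq_lintegral]
  · have h : ∀ᵐ x ∂P, ∀ n, (w n : Lp ℂ 2 P) x = A.koopmanFun g⁻¹ (w n : Lp ℂ 2 P) x :=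
      ae_all_iff.2 fun n => by
        have := A.koopman_ae_eq g⁻¹ (w n : Lp ℂ 2 P)
        rwa [(w n).2 g⁻¹] at this
    filter_upwards [h] with x hx
    rw [← ENNReal.tsum_mul_left]
    refine tsum_congr fun n => ?_
    rw [hx n, A.enorm_koopmanFun_sq, inv_inv, mul_assoc]
  · set Z : Set X := {x | ∑' n, ‖(w n : Lp ℂ 2 P) x‖ₑ ^ 2 * (a n : ℝ≥0∞) = 0} with hZ_def
    have hZ : MeasurableSet Z := Measurable.tsum hmeas (measurableSet_singleton 0)
    have hwZ : ∀ n, ∀ x ∈ Z, (w n : Lp ℂ 2 P) x = 0 := fun n x hx => by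
      have h1 := ENNReal.tsum_eq_zero.1 hx n
      have h2 : (a n : ℝ≥0∞) ≠ 0 := by exact_mod_cast (ha n).ne'
      simpa [h2] using h1
    have h0 : ∫⁻ x in Z, ‖v x‖ₑ ^ 2 ∂P = 0 := by
      refine le_antisymm (le_of_forall_gt fun ε hε => ?_) zero_le
      obtain ⟨δ, hδ, hδε⟩ : ∃ δ : ℝ≥0∞, 0 < δ ∧ δ ^ 2 < ε := by
        have : ∀ᶠ δ in 𝓝[>] (0 : ℝ≥0∞), δ ^ 2 < ε :=
          ((ENNReal.continuous_pow 2).tendsto' 0 0 (by simp)).mono_left nhdsWithin_le_nhds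
            |>.eventually (eventually_lt_nhds hε)
        obtain ⟨δ, h1, h2⟩ := (this.and self_mem_nhdsWithin).exists
        exact ⟨δ, h2, h1⟩
      obtain ⟨n, hn⟩ := (TopologicalSpace.denseRange_denseSeq W).exists_mem_open
        (Metric.isOpen_eball (x := (⟨v, hv⟩ : W)) (ε := δ)) ⟨_, Metric.mem_eball_self hδ⟩
      refine (setLIntegral_enorm_sq_le hZ (w := (w n : Lp ℂ 2 P))
        (Eventually.of_forall (hwZ n))).trans_lt (lt_of_le_of_lt ?_ hδε)
      gcongr
      rw [← edist_eq_enorm_sub, edist_comm]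
      exact le_of_lt hn
    rw [lintegral_eq_zero_iff
      ((Lp.stronglyMeasurable v).measurable.enorm.pow_const 2)] at h0
    filter_upwards [(ae_restrict_iff' hZ).1 h0] with x hx hxZ
    simpa using hx hxZ

/-- If densities supported in `Z` are asymptotically invariant and their mass stays at most one and
away from zero, then some vector of `L²` that is invariant under a group with property (T) does not
vanish on `Z`. -/
lemma exists_invariant_ne_zero [TopologicalSpace G] [IsTopologicalGroup G] [T2Space G]
    [LocallyCompactSpace G] [BorelSpace G] (hG : HasPropertyT G) [SFinite P]
    [MeasurableSpace.CountablyGenerated X] {Z : Set X} (hZ : MeasurableSet Z)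
    {q : ℕ → X → ℝ} (hq : ∀ n, Measurable (q n)) (hq0 : ∀ n x, 0 ≤ q n x)
    (hqZ : ∀ n, ∀ x ∉ Z, q n x = 0) {c : ℝ≥0∞} (hc : 0 < c)
    (hcq : ∀ n, c ≤ ∫⁻ x, ENNReal.ofReal (q n x) ∂P)
    (hq1 : ∀ n, ∫⁻ x, ENNReal.ofReal (q n x) ∂P ≤ 1)
    (hlim : ∀ g, Tendsto (fun n => ∫⁻ x,
      ENNReal.ofReal |A.jac g x * q n (A.act g x) - q n x| ∂P) atTop (𝓝 0)) :
    ∃ w : Lp ℂ 2 P, (∀ g, A.koopman g w = w) ∧ ¬ ∀ᵐ x ∂P, x ∈ Z → w x = 0 := by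
  have : Fact ((2 : ℝ≥0∞) ≠ ⊤) := ⟨ENNReal.ofNat_ne_top⟩
  let f : ℕ → X → ℂ := fun n x => (√(q n x) : ℝ)
  have hf : ∀ n, Measurable (f n) := fun n => Complex.measurable_ofReal.comp (hq n).sqrt
  have hfq : ∀ n x, ‖f n x‖ₑ ^ 2 = ENNReal.ofReal (q n x) := fun n x => by
    rw [← ofReal_norm, Complex.norm_real, Real.norm_of_nonneg (Real.sqrt_nonneg _),
      ← ENNReal.ofReal_pow (Real.sqrt_nonneg _), Real.sq_sqrt (hq0 n x)]
  have hnorm : ∀ n, eLpNorm (f n) 2 P ^ 2 = ∫⁻ x, ENNReal.ofReal (q n x) ∂P := fun n => by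
    rw [eLpNorm_two_sq]
    exact lintegral_congr (hfq n)
  have hmem : ∀ n, MemLp (f n) 2 P := fun n => by
    refine ⟨(hf n).aestronglyMeasurable, lt_top_iff_ne_top.2 fun h => ?_⟩
    have := (hnorm n).trans_le (hq1 n)
    rw [h] at this
    simp at this
  let x : ℕ → Lp ℂ 2 P := fun n => (hmem n).toLp _
  have hx : ∀ n, ‖x n‖ₑ ^ 2 = ∫⁻ x, ENNReal.ofReal (q n x) ∂P := fun n => by
    rw [Lp.enorm_toLp, hnorm]
  have hc1 : c ≤ 1 := (hcq 0).trans (hq1 0)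
  have hctop : c ≠ ⊤ := ne_top_of_le_ne_top ENNReal.one_ne_top hc1
  have hxc : ∀ n, √c.toReal ≤ ‖x n‖ := fun n => by
    refine Real.sqrt_le_left (norm_nonneg _) |>.2 ?_
    rw [← toReal_enorm, ← ENNReal.toReal_pow]
    refine ENNReal.toReal_mono (ENNReal.pow_ne_top enorm_ne_top) ?_
    rw [hx]
    exact hcq n
  have hxlim : ∀ g, Tendsto (fun n => ‖A.koopman g (x n) - x n‖) atTop (𝓝 0) := fun g => by
    have hsq : Tendsto (fun n => ‖A.koopman g (x n) - x n‖ₑ ^ 2) atTop (𝓝 0) := by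
      refine tendsto_of_tendsto_of_tendsto_of_le_of_le tendsto_const_nhds (hlim g⁻¹)
        (fun _ => zero_le) fun n => ?_
      change ‖A.koopman g (x n) - x n‖ₑ ^ 2 ≤ _
      rw [enorm_sq_eq_lintegral]
      refine lintegral_mono_ae ?_
      filter_upwards [Lp.coeFn_sub (A.koopman g (x n)) (x n), A.koopman_ae_eq g (x n),
        A.koopmanFun_congr g (hmem n).coeFn_toLp, (hmem n).coeFn_toLp] with y h1 h2 h3 h4
      rw [h1, Pi.sub_apply, h2, h3, h4]
      have e : A.koopmanFun g (f n) y - f n y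
          = ((√(A.jac g⁻¹ y * q n (A.act g⁻¹ y)) - √(q n y) : ℝ) : ℂ) := by
        rw [koopmanFun, Real.sqrt_mul (A.jac_pos _ _).le]
        push_cast
        rfl
      rw [e, ← ofReal_norm, Complex.norm_real, ← ENNReal.ofReal_pow (norm_nonneg _),
        Real.norm_eq_abs, sq_abs]
      exact ENNReal.ofReal_le_ofReal
        (sqrt_sub_sqrt_sq_le (mul_nonneg (A.jac_pos _ _).le (hq0 _ _)) (hq0 _ _))
    have h1 := (ENNReal.tendsto_toReal ENNReal.zero_ne_top).comp hsq
    have h2 := (Real.continuous_sqrt.tendsto _).comp h1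
    simpa [Function.comp_def, Real.sqrt_sq] using h2
  obtain ⟨n, w, hw, hwx⟩ := hG.exists_invariant_near A.koopman A.continuous_koopman
    (Real.sqrt_pos.2 (ENNReal.toReal_pos hc.ne' hctop)) hxc hxlim (ε := 1 / 2) (by norm_num)
  refine ⟨w, hw, fun hwZ => ?_⟩
  have h1 := setLIntegral_enorm_sq_le (v := x n) hZ hwZ
  have h2 : ∫⁻ y in Z, ‖x n y‖ₑ ^ 2 ∂P = ‖x n‖ₑ ^ 2 := by
    rw [enorm_sq_eq_lintegral, ← lintegral_indicator hZ]
    refine lintegral_congr_ae ?_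
    filter_upwards [(hmem n).coeFn_toLp] with y hy
    by_cases hyZ : y ∈ Z
    · rw [indicator_of_mem hyZ]
    · rw [indicator_of_notMem hyZ, hy, hfq, hqZ n y hyZ, ENNReal.ofReal_zero]
  rw [h2, enorm_sub_rev] at h1
  have h3 : ‖x n‖ ^ 2 ≤ ‖w - x n‖ ^ 2 := by
    have := ENNReal.toReal_mono (ENNReal.pow_ne_top enorm_ne_top) h1
    simpa using this
  have h4 : 0 < ‖x n‖ := (Real.sqrt_pos.2 (ENNReal.toReal_pos hc.ne' hctop)).trans_le (hxc n)
  have h5 : ‖x n‖ ≤ ‖w - x n‖ := (sq_le_sq₀ h4.le (norm_nonneg _)).1 h3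
  linarith

end NonsingularAction

/-! ### The skew product as a nonsingular action -/

namespace DiffPlus

lemma continuous_toContinuousMap : Continuous fun f : DiffPlus => (f.toHomeo : C(I, I)) :=
  continuous_fst.comp (continuous_induced_dom
    (f := fun f : DiffPlus => ((f.toHomeo : C(I, I)), f.derivative)))

lemma continuous_derivative : Continuous DiffPlus.derivative :=
  continuous_snd.comp (continuous_induced_dom
    (f := fun f : DiffPlus => ((f.toHomeo : C(I, I)), f.derivative)))

lemma measurable_eval : Measurable fun p : DiffPlus × I => p.1.toHomeo p.2 :=
  (measurable_uncurry_of_continuous_of_measurable (u := fun (s : I) (f : DiffPlus) => f.toHomeo s)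
    (fun f => f.toHomeo.continuous) fun s =>
      ((continuous_eval_const s).comp continuous_toContinuousMap).measurable).comp
    measurable_swap

lemma measurable_derivative_eval : Measurable fun p : DiffPlus × I => p.1.derivative p.2 :=
  (measurable_uncurry_of_continuous_of_measurable
    (u := fun (s : I) (f : DiffPlus) => f.derivative s)
    (fun f => f.derivative.continuous) fun s =>
      ((continuous_eval_const s).comp continuous_derivative).measurable).comp
    measurable_swap

end DiffPlus

section Skew

variable {G : Type u} [Group G] [MeasurableSpace G] {M : Type v} [MeasurableSpace M] [MulAction G M]
  {μ : Measure M} {α : G × M → DiffPlus}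

omit [Group G] [MeasurableSpace G] [MulAction G M] in
lemma ae_prod_of_ae {p : M → Prop} (h : ∀ᵐ m ∂μ, p m) :
    ∀ᵐ x ∂(μ.prod (volume : Measure I)), p x.1 :=
  Measure.quasiMeasurePreserving_fst.ae h

/-- A cocycle over a measure preserving action is trivial at the identity. -/
lemma IsBorelCocycle.ae_one (hα : IsBorelCocycle μ α) : ∀ᵐ m ∂μ, α (1, m) = 1 := by
  filter_upwards [hα.2 1 1] with m hm
  rw [one_smul, mul_one] at hm
  exact (mul_eq_left.1 hm.symm)

variable [MeasurableSMul₂ G M] [SFinite μ] [SMulInvariantMeasure G M μ]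

/-- The action of `G` on `M ×_α I`. It is nonsingular for `μ × λ`, with Jacobian the derivative of
the cocycle. -/
def skewAction (hα : IsBorelCocycle μ α) : NonsingularAction G (μ.prod (volume : Measure I)) where
  act := skewMap α
  jac g x := (α (g, x.1)).derivative x.2
  measurable_act := by
    have hα' := hα.1
    exact Measurable.prodMk (by fun_prop : Measurable fun p : G × M × I => p.1 • p.2.1)
      (DiffPlus.measurable_eval.comp
        (by fun_prop : Measurable fun p : G × M × I => (α (p.1, p.2.1), p.2.2)))
  measurable_jac := by
    have hα' := hα.1
    exact DiffPlus.measurable_derivative_eval.comp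
      (by fun_prop : Measurable fun p : G × M × I => (α (p.1, p.2.1), p.2.2))
  jac_pos g x := DiffPlus.derivative_pos _ _
  lintegral_jac_mul g F hF := by
    have hα' := hα.1
    have h1 : Measurable fun x : M × I => (α (g, x.1), x.2) := by fun_prop
    have h2 : Measurable fun x : M × I => skewMap α g x :=
      Measurable.prodMk (by fun_prop) (DiffPlus.measurable_eval.comp h1)
    rw [lintegral_prod (fun x : M × I => ENNReal.ofReal ((α (g, x.1)).derivative x.2) *
      F (skewMap α g x)) (((DiffPlus.measurable_derivative_eval.comp h1).ennreal_ofReal.mul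
      (hF.comp h2)).aemeasurable), lintegral_prod _ hF.aemeasurable]
    have h3 : ∀ m, ∫⁻ s : I, ENNReal.ofReal ((α (g, m)).derivative s) * F (skewMap α g (m, s))
        = ∫⁻ s : I, F (g • m, s) := fun m =>
      (α (g, m)).lintegral_derivative_mul_comp fun s => F (g • m, s)
    simp only [h3]
    exact (measurePreserving_smul g μ).lintegral_comp hF.lintegral_prod_right'
  act_one := by
    filter_upwards [ae_prod_of_ae hα.ae_one] with x hx
    rw [skewMap, one_smul, hx, map_one]
    rfl
  act_mul g h := by
    filter_upwards [ae_prod_of_ae (hα.2 g h)] with x hx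
    simp only [skewMap, mul_smul, hx, map_mul]
    rfl
  jac_one := by
    filter_upwards [ae_prod_of_ae hα.ae_one] with x hx
    rw [hx, DiffPlus.derivative_one]
  jac_mul g h := by
    filter_upwards [ae_prod_of_ae (hα.2 g h)] with x hx
    rw [hx, DiffPlus.derivative_mul]
    rfl

end Skew

/-! ### Almost invariant vectors on invariant subsets of the skew product -/

section SkewDensity

variable {M : Type v} [MeasurableSpace M]

/-- The family of the densities `fiberDensity` of the sections of `Z`. -/
def skewDensity (Z : Set (M × I)) (n : ℕ) (x : M × I) : ℝ := fiberDensity (Prod.mk x.1 ⁻¹' Z) n x.2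

lemma measurable_skewDensity {Z : Set (M × I)} (hZ : MeasurableSet Z) (n : ℕ) :
    Measurable (skewDensity Z n) := by
  have hE : MeasurableSet {p : (M × I) × I | p.2 ≤ p.1.2 ∧ (p.1.1, p.2) ∈ Z} :=
    (measurableSet_le (by fun_prop) (by fun_prop)).inter
      ((by fun_prop : Measurable fun p : (M × I) × I => (p.1.1, p.2)) hZ)
  have h1 : Measurable fun x : M × I => (volume.restrict (Prod.mk x.1 ⁻¹' Z)).real (Iic x.2) := by
    convert (measurable_measure_prodMk_left (ν := (volume : Measure I)) hE).ennreal_toReal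
      using 2 with x
    rw [measureReal_def, Measure.restrict_apply measurableSet_Iic]
    rfl
  exact ((measurable_powerDensity n).comp h1).indicator hZ

omit [MeasurableSpace M] in
lemma skewDensity_nonneg (Z : Set (M × I)) (n : ℕ) (x : M × I) : 0 ≤ skewDensity Z n x :=
  fiberDensity_nonneg _ _ _

variable {μ : Measure M} [IsProbabilityMeasure μ]

lemma lintegral_skewDensity_le_one {Z : Set (M × I)} (hZ : MeasurableSet Z) (n : ℕ) :
    ∫⁻ x, ENNReal.ofReal (skewDensity Z n x) ∂(μ.prod volume) ≤ 1 := by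
  rw [lintegral_prod _ (measurable_skewDensity hZ n).ennreal_ofReal.aemeasurable]
  calc _ ≤ ∫⁻ _, 1 ∂μ :=
        lintegral_mono fun m => lintegral_fiberDensity_le_one (measurable_prodMk_left hZ) n
    _ = 1 := by simp

omit [IsProbabilityMeasure μ] in
lemma le_lintegral_skewDensity [SFinite μ] {Z : Set (M × I)} (hZ : MeasurableSet Z) (n : ℕ) :
    μ.prod volume Z ≤ ∫⁻ x, ENNReal.ofReal (skewDensity Z n x) ∂(μ.prod volume) := by
  rw [lintegral_prod _ (measurable_skewDensity hZ n).ennreal_ofReal.aemeasurable,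
    Measure.prod_apply hZ]
  exact lintegral_mono fun m => le_lintegral_fiberDensity (measurable_prodMk_left hZ) n

variable {G : Type u} [Group G] [MeasurableSpace G] [MulAction G M] {α : G × M → DiffPlus}
  [MeasurableSMul₂ G M] [SMulInvariantMeasure G M μ]

/-- On an invariant subset `Z` of the skew product, the densities `skewDensity Z n` are
asymptotically invariant: this holds on each fibre, and the fibres are integrated by dominated
convergence. -/
lemma tendsto_lintegral_skewDensity (hα : IsBorelCocycle μ α) {Z : Set (M × I)}
    (hZ : MeasurableSet Z) (g : G)
    (hinv : ∀ᵐ x ∂(μ.prod volume), x ∈ Z ↔ skewMap α g x ∈ Z) :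
    Tendsto (fun n => ∫⁻ x, ENNReal.ofReal
      |(α (g, x.1)).derivative x.2 * skewDensity Z n (skewMap α g x) - skewDensity Z n x|
        ∂(μ.prod volume)) atTop (𝓝 0) := by
  have hmeas : ∀ n, Measurable fun x => ENNReal.ofReal
      |(α (g, x.1)).derivative x.2 * skewDensity Z n (skewMap α g x) - skewDensity Z n x| :=
    fun n => ((((skewAction hα).measurable_jac_left g).mul ((measurable_skewDensity hZ n).comp
      ((skewAction hα).measurable_act_left g))).sub
        (measurable_skewDensity hZ n)).abs.ennreal_ofReal
  have hsec : ∀ m, MeasurableSet (Prod.mk m ⁻¹' Z) := fun m => measurable_prodMk_left hZ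
  refine Tendsto.congr (fun n => (lintegral_prod _ (hmeas n).aemeasurable).symm) ?_
  have h := tendsto_lintegral_of_dominated_convergence (μ := μ) (f := fun _ => 0)
    (F := fun n m => ∫⁻ s, ENNReal.ofReal |(α (g, m)).derivative s *
      fiberDensity (Prod.mk (g • m) ⁻¹' Z) n ((α (g, m)).toHomeo s)
        - fiberDensity (Prod.mk m ⁻¹' Z) n s|) (fun _ => 2)
    (fun n => (hmeas n).lintegral_prod_right')
    (fun n => Eventually.of_forall fun m =>
      lintegral_abs_fiberDensity_le_two (α (g, m)) (hsec m) (hsec (g • m)) n)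
    (by simp) (by
      filter_upwards [Measure.ae_ae_of_ae_prod hinv] with m hm
      exact tendsto_lintegral_fiberDensity (α (g, m)) (hsec m) (hsec (g • m)) hm)
  rw [lintegral_zero] at h
  exact h

/-- Over a group with property (T), the skew product carries an invariant density that is almost
everywhere nonzero. Take an invariant density that dominates all others. Its zero set `Z` is
invariant, so if `Z` were not null then property (T), applied to the asymptotically invariant
densities in `Z`, would give an invariant vector that does not vanish on `Z`. -/
lemma exists_invariant_density_ne_zero [TopologicalSpace G] [IsTopologicalGroup G] [T2Space G]
    [LocallyCompactSpace G] [BorelSpace G] (hG : HasPropertyT G) [StandardBorelSpace M]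
    (hα : IsBorelCocycle μ α) :
    ∃ d : M × I → ℝ≥0∞, Measurable d ∧ ∫⁻ x, d x ∂(μ.prod volume) ≠ ⊤ ∧
      (∀ g : G, ∀ᵐ x ∂(μ.prod volume),
        d x = ENNReal.ofReal ((α (g, x.1)).derivative x.2) * d (skewMap α g x)) ∧
      ∀ᵐ x ∂(μ.prod volume), d x ≠ 0 := by
  let A := skewAction hα
  obtain ⟨d, hd, hfin, hinv, hmax⟩ := A.exists_invariant_density
  refine ⟨d, hd, hfin, hinv, ?_⟩
  let Z : Set (M × I) := {x | d x = 0}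
  have hZ : MeasurableSet Z := hd (measurableSet_singleton 0)
  by_contra hne
  have hpos : 0 < μ.prod volume Z := by
    refine pos_iff_ne_zero.2 fun h => hne ?_
    rw [ae_iff]
    simpa only [not_not] using h
  have hqZ : ∀ n, ∀ x ∉ Z, skewDensity Z n x = 0 := fun n x hx => by
    unfold skewDensity fiberDensity
    exact indicator_of_notMem (s := Prod.mk x.1 ⁻¹' Z) (mem_preimage.not.2 hx) _
  obtain ⟨w, hw, hwZ⟩ := A.exists_invariant_ne_zero hG hZ (measurable_skewDensity hZ)
    (skewDensity_nonneg Z) hqZ hpos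
    (le_lintegral_skewDensity hZ) (lintegral_skewDensity_le_one hZ) fun g => by
      refine tendsto_lintegral_skewDensity hα hZ g ?_
      filter_upwards [hinv g] with x hx
      have h0 : ENNReal.ofReal (A.jac g x) ≠ 0 := (ENNReal.ofReal_pos.2 (A.jac_pos g x)).ne'
      change d x = 0 ↔ d (A.act g x) = 0
      rw [hx, mul_eq_zero, or_iff_right h0]
  exact hwZ (hmax w hw)

/-- The invariant density, normalised to be a probability density on each fibre. -/
lemma exists_invariant_fiber_density [TopologicalSpace G] [IsTopologicalGroup G] [T2Space G]
    [LocallyCompactSpace G] [BorelSpace G] (hG : HasPropertyT G) [StandardBorelSpace M]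
    (hα : IsBorelCocycle μ α) :
    ∃ k : M × I → ℝ≥0∞, Measurable k ∧ (∀ m, ∫⁻ s, k (m, s) = 1) ∧
      (∀ m, ∀ᵐ s, k (m, s) ≠ 0) ∧
      ∀ g : G, ∀ᵐ m ∂μ, ∀ᵐ s : I, k (m, s) =
        ENNReal.ofReal ((α (g, m)).derivative s) * k (g • m, (α (g, m)).toHomeo s) := by
  obtain ⟨d, hd, hfin, hinv, hne⟩ := exists_invariant_density_ne_zero hG hα
  let U : M → ℝ≥0∞ := fun m => ∫⁻ s, d (m, s)
  have hU : Measurable U := hd.lintegral_prod_right'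
  let Y : Set M := {m | U m ≠ ⊤ ∧ volume {s | d (m, s) = 0} = 0}
  have hY : MeasurableSet Y := by
    refine (hU (measurableSet_singleton ⊤).compl).inter ?_
    exact measurable_measure_prodMk_left (hd (measurableSet_singleton 0))
      (measurableSet_singleton 0)
  have hYae : ∀ᵐ m ∂μ, m ∈ Y := by
    have h1 : ∀ᵐ m ∂μ, U m < ⊤ := by
      refine ae_lt_top hU ?_
      rwa [lintegral_prod _ hd.aemeasurable] at hfin
    filter_upwards [h1, Measure.ae_ae_of_ae_prod hne] with m hm1 hm2
    refine ⟨hm1.ne, ?_⟩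
    rw [ae_iff] at hm2
    simpa only [not_not] using hm2
  have hYne : ∀ m ∈ Y, ∀ᵐ s : I, d (m, s) ≠ 0 := fun m hm => by
    rw [ae_iff]
    simpa only [not_not] using hm.2
  have hU0 : ∀ m ∈ Y, U m ≠ 0 := fun m hm h => by
    have h := (lintegral_eq_zero_iff (hd.comp measurable_prodMk_left)).1 h
    obtain ⟨s, hs1, hs2⟩ := (h.and (hYne m hm)).exists
    exact hs2 hs1
  classical
  let k : M × I → ℝ≥0∞ := fun x => if x.1 ∈ Y then d x / U x.1 else 1
  have hk : Measurable k := Measurable.ite (measurable_fst hY) (hd.div (hU.comp measurable_fst))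
    measurable_const
  refine ⟨k, hk, fun m => ?_, fun m => ?_, fun g => ?_⟩
  · by_cases hm : m ∈ Y
    · simp only [k, if_pos hm, div_eq_mul_inv]
      rw [lintegral_mul_const' _ _ (ENNReal.inv_ne_top.2 (hU0 m hm))]
      exact ENNReal.mul_inv_cancel (hU0 m hm) hm.1
    · simp [k, hm]
  · by_cases hm : m ∈ Y
    · filter_upwards [hYne m hm] with s hs
      simp only [k, if_pos hm]
      exact ENNReal.div_ne_zero.2 ⟨hs, hm.1⟩
    · simp [k, hm]
  · filter_upwards [hYae, (measurePreserving_smul g μ).quasiMeasurePreserving.ae hYae,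
      Measure.ae_ae_of_ae_prod (hinv g)] with m hm hgm h
    have hUg : U (g • m) = U m :=
      ((α (g, m)).lintegral_derivative_mul_comp fun s => d (g • m, s)).symm.trans
        (lintegral_congr_ae h).symm
    filter_upwards [h] with s hs
    simp only [k, if_pos hm, if_pos hgm, hUg]
    rw [hs, mul_div_assoc]
    rfl

end SkewDensity

/-! ### Homeomorphisms that straighten a measure on the interval -/

/-- A map into `C(I, I)` is Borel as soon as its evaluations are: distances to a fixed map are
suprema over a countable dense set of points. -/
lemma measurable_continuousMap {X : Type*} [MeasurableSpace X] {h : X → C(I, I)}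
    (hh : ∀ s, Measurable fun x => h x s) : @Measurable X C(I, I) _ (borel C(I, I)) h := by
  have hdist : ∀ c : C(I, I), Measurable fun x => dist (h x) c := fun c => by
    refine measurable_of_Iic fun r => ?_
    rcases lt_or_ge r 0 with hr | hr
    · convert MeasurableSet.empty
      exact eq_empty_of_forall_notMem fun x hx => (hr.trans_le dist_nonneg).not_ge hx
    · have e : (fun x => dist (h x) c) ⁻¹' Iic r
          = ⋂ n, {x | dist (h x (TopologicalSpace.denseSeq I n))
              (c (TopologicalSpace.denseSeq I n)) ≤ r} := by
        ext x
        rw [mem_preimage, mem_Iic, ContinuousMap.dist_le hr, mem_iInter]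
        refine ⟨fun H n => H _, fun H s => ?_⟩
        exact (TopologicalSpace.denseRange_denseSeq I).induction_on s
          (isClosed_le (by fun_prop) continuous_const) H
      rw [e]
      exact MeasurableSet.iInter fun n => measurableSet_le ((hh _).dist measurable_const)
        measurable_const
  refine measurable_generateFrom fun U hU => ?_
  have hU : IsOpen U := hU
  choose r hr hrU using Metric.isOpen_iff.1 hU
  obtain ⟨T, hT, hTU⟩ := TopologicalSpace.isOpen_iUnion_countable
    (fun c : U => Metric.ball (c : C(I, I)) (r c c.2)) fun _ => Metric.isOpen_ball
  have e : U = ⋃ c ∈ T, Metric.ball (c : C(I, I)) (r c c.2) := by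
    rw [hTU]
    refine Subset.antisymm (fun c hc => mem_iUnion.2 ⟨⟨c, hc⟩, Metric.mem_ball_self (hr c hc)⟩) ?_
    exact iUnion_subset fun c => hrU c c.2
  rw [e, preimage_iUnion₂]
  exact MeasurableSet.biUnion hT fun c _ => measurableSet_lt (hdist c) measurable_const

namespace HomeoLebPlus

lemma toHomeo_injective : Function.Injective HomeoLebPlus.toHomeo := Subtype.val_injective

lemma measurable_of_eval {X : Type*} [MeasurableSpace X] {h : X → HomeoLebPlus}
    (hh : ∀ s, Measurable fun x => (h x).toHomeo s) : Measurable h := by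
  change @Measurable X HomeoLebPlus _ (@borel HomeoLebPlus (.induced _ _)) h
  rw [borel_comap, measurable_comap_iff]
  exact measurable_continuousMap hh

end HomeoLebPlus

lemma DiffPlus.measurable_toHomeoLeb : Measurable DiffPlus.toHomeoLeb :=
  HomeoLebPlus.measurable_of_eval fun s =>
    ((continuous_eval_const s).comp DiffPlus.continuous_toContinuousMap).measurable

section Straighten

variable (κ : Measure I) [IsProbabilityMeasure κ]

/-- The distribution function of a probability measure on `I`, as a map from `I` to itself. -/
def distributionMap (s : I) : I := ⟨κ.real (Iic s), measureReal_nonneg, measureReal_le_one⟩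

variable {κ} (h₁ : κ ≪ volume) (h₂ : (volume : Measure I) ≪ κ)

include h₂ in
lemma strictMono_distributionMap : StrictMono (distributionMap κ) := fun a b hab => by
  change κ.real (Iic a) < κ.real (Iic b)
  have hpos : 0 < κ.real (Ioc a b) := by
    refine measureReal_nonneg.lt_of_ne' fun h => ?_
    have := h₂ ((measureReal_eq_zero_iff (measure_ne_top _ _)).1 h)
    rw [unitInterval.volume_Ioc, ENNReal.ofReal_eq_zero, sub_nonpos] at this
    exact hab.not_ge this
  have : κ.real (Iic b) = κ.real (Iic a) + κ.real (Ioc a b) := by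
    rw [← measureReal_union _ measurableSet_Ioc, Iic_union_Ioc_eq_Iic hab.le]
    exact disjoint_left.2 fun x hx hx' => hx'.1.not_ge hx
  linarith

include h₁ in
lemma continuous_distributionMap : Continuous (distributionMap κ) := by
  have : NullSingletonClass κ := ⟨fun x => h₁ (measure_singleton x)⟩
  exact (continuous_real_Iic κ).subtype_mk _

include h₁ in
lemma surjective_distributionMap : Function.Surjective (distributionMap κ) := by
  have : NullSingletonClass κ := ⟨fun x => h₁ (measure_singleton x)⟩
  have h0 : distributionMap κ 0 = 0 := Subtype.ext (real_Iic_zero κ)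
  have h1 : distributionMap κ 1 = 1 := Subtype.ext ((real_Iic_one κ).trans probReal_univ)
  exact fun y => mem_range_of_exists_le_of_exists_ge (continuous_distributionMap h₁)
    ⟨0, h0.trans_le unitInterval.nonneg'⟩ ⟨1, unitInterval.le_one'.trans_eq h1.symm⟩

include h₁ in
lemma map_distributionMap : κ.map (distributionMap κ) = volume := by
  have : NullSingletonClass κ := ⟨fun x => h₁ (measure_singleton x)⟩
  refine unitInterval.measurableEmbedding_coe.map_injective ?_
  rw [Measure.map_map measurable_subtype_coe (continuous_distributionMap h₁).measurable,
    unitInterval.measurePreserving_coe.map_eq]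
  have := map_real_Iic κ
  rwa [probReal_univ] at this

/-- The distribution function of a probability measure equivalent to `λ`, as a homeomorphism. -/
def distributionHomeo : I ≃ₜ I :=
  ((strictMono_distributionMap h₂).orderIsoOfSurjective _
    (surjective_distributionMap h₁)).toHomeomorph

lemma distributionHomeo_mem : distributionHomeo h₁ h₂ ∈ homeoLebSubgroup := by
  have e : ⇑(distributionHomeo h₁ h₂) = distributionMap κ := rfl
  have hm : Measurable (distributionMap κ) := (continuous_distributionMap h₁).measurable
  refine ⟨strictMono_distributionMap h₂, ?_, ?_⟩
  · rw [e]
    simpa only [map_distributionMap h₁] using h₂.map hm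
  · rw [e]
    simpa only [map_distributionMap h₁] using h₁.map hm

/-- The homeomorphism of `I` that carries Lebesgue measure to `κ`. -/
def straighten : HomeoLebPlus :=
  (⟨distributionHomeo h₁ h₂, distributionHomeo_mem h₁ h₂⟩ : homeoLebSubgroup)⁻¹

lemma toHomeo_straighten_inv : (straighten h₁ h₂)⁻¹.toHomeo = distributionHomeo h₁ h₂ := by
  rw [straighten]
  exact congrArg HomeoLebPlus.toHomeo (inv_inv _)

lemma straighten_le_iff (s x : I) :
    (straighten h₁ h₂).toHomeo s ≤ x ↔ (s : ℝ) ≤ κ.real (Iic x) := by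
  have e : distributionHomeo h₁ h₂ ((straighten h₁ h₂).toHomeo s) = s := by
    rw [← toHomeo_straighten_inv h₁ h₂, map_inv]
    exact (straighten h₁ h₂).toHomeo.symm_apply_apply s
  rw [← (strictMono_distributionMap h₂).le_iff_le,
    show distributionMap κ ((straighten h₁ h₂).toHomeo s) = s from e]
  rfl

end Straighten

/-! ### The invariant measure and the coboundary -/

section Final

variable {G : Type u} [Group G] {M : Type v} [MeasurableSpace M] [MulAction G M]
  {μ : Measure M} {α : G × M → DiffPlus} {k : M × I → ℝ≥0∞}

/-- The homeomorphisms that carry `λ` to the conditional measures of an invariant measure are a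
coboundary for the cocycle. -/
lemma cohomologous_one (hk : Measurable k)
    (hk1 : ∀ m, ∫⁻ s, k (m, s) = 1) (hk0 : ∀ m, ∀ᵐ s, k (m, s) ≠ 0)
    (hinv : ∀ g : G, ∀ᵐ m ∂μ, ∀ᵐ s : I, k (m, s) =
      ENNReal.ofReal ((α (g, m)).derivative s) * k (g • m, (α (g, m)).toHomeo s)) :
    Cohomologous μ (fun p : G × M => (α p).toHomeoLeb) (fun _ => 1) := by
  let κ : M → Measure I := fun m => volume.withDensity fun s => k (m, s)
  have hks : ∀ m, Measurable fun s => k (m, s) := fun m => hk.comp measurable_prodMk_left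
  have hκ : ∀ m, IsProbabilityMeasure (κ m) := fun m => ⟨by
    rw [withDensity_apply _ MeasurableSet.univ, setLIntegral_univ, hk1]⟩
  have h₁ : ∀ m, κ m ≪ volume := fun m => withDensity_absolutelyContinuous _ _
  have h₂ : ∀ m, volume ≪ κ m := fun m =>
    withDensity_absolutelyContinuous' (hks m).aemeasurable (hk0 m)
  have hκx : ∀ x, Measurable fun m => (κ m).real (Iic x) := fun x => by
    have : ∀ m, (κ m).real (Iic x) = (∫⁻ s in Iic x, k (m, s)).toReal := fun m => by
      rw [measureReal_def, withDensity_apply _ measurableSet_Iic]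
    simp_rw [this]
    exact (hk.lintegral_prod_right' (ν := volume.restrict (Iic x))).ennreal_toReal
  refine ⟨fun m => straighten (h₁ m) (h₂ m), HomeoLebPlus.measurable_of_eval fun s =>
    measurable_of_Iic fun x => ?_, fun g => ?_⟩
  · have e : (fun m => (straighten (h₁ m) (h₂ m)).toHomeo s) ⁻¹' Iic x
        = {m | (s : ℝ) ≤ (κ m).real (Iic x)} := by
      ext m
      exact straighten_le_iff (h₁ m) (h₂ m) s x
    rw [e]
    exact measurableSet_le measurable_const (hκx x)
  · filter_upwards [hinv g] with m hm
    have key : (straighten (h₁ (g • m)) (h₂ (g • m)))⁻¹ * (α (g, m)).toHomeoLeb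
        = (straighten (h₁ m) (h₂ m))⁻¹ := by
      refine HomeoLebPlus.toHomeo_injective ?_
      rw [map_mul, toHomeo_straighten_inv, toHomeo_straighten_inv]
      ext s
      change (κ (g • m)).real (Iic ((α (g, m)).toHomeo s)) = (κ m).real (Iic s)
      rw [measureReal_def, measureReal_def, withDensity_apply _ measurableSet_Iic,
        withDensity_apply _ measurableSet_Iic, ← lintegral_indicator measurableSet_Iic,
        ← lintegral_indicator measurableSet_Iic, ← (α (g, m)).lintegral_derivative_mul_comp]
      congr 1
      refine lintegral_congr_ae ?_
      filter_upwards [hm] with x hx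
      by_cases hxs : x ≤ s
      · rw [indicator_of_mem (mem_Iic.2 hxs),
          indicator_of_mem (mem_Iic.2 ((α (g, m)).strictMono.monotone hxs)), hx]
      · rw [indicator_of_notMem (mem_Iic.not.2 hxs), indicator_of_notMem
          (mem_Iic.not.2 fun h => hxs ((α (g, m)).strictMono.le_iff_le.1 h)), mul_zero]
    rw [key, inv_mul_cancel]

variable [MeasurableSpace G] [MeasurableSMul₂ G M] [IsProbabilityMeasure μ]
  [SMulInvariantMeasure G M μ]

/-- The measure with density `k` with respect to `μ × λ` is invariant and projects to `μ`. -/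
lemma exists_invariant_measure (hα : IsBorelCocycle μ α) (hk : Measurable k)
    (hk1 : ∀ m, ∫⁻ s, k (m, s) = 1) (hk0 : ∀ m, ∀ᵐ s, k (m, s) ≠ 0)
    (hinv : ∀ g : G, ∀ᵐ m ∂μ, ∀ᵐ s : I, k (m, s) =
      ENNReal.ofReal ((α (g, m)).derivative s) * k (g • m, (α (g, m)).toHomeo s)) :
    ∃ ν : Measure (M × I), IsProbabilityMeasure ν ∧
      (∀ g : G, MeasurePreserving (skewMap α g) ν ν) ∧
      (ν ≪ μ.prod volume ∧ μ.prod volume ≪ ν) ∧ ν.map Prod.fst = μ := by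
  let A := skewAction hα
  have hfst : ((μ.prod volume).withDensity k).map Prod.fst = μ := by
    ext B hB
    rw [Measure.map_apply measurable_fst hB, withDensity_apply _ (measurable_fst hB),
      ← Set.prod_univ, setLIntegral_prod _ hk.aemeasurable]
    simp [hk1]
  have hsec : ∀ g, ∀ᵐ x ∂(μ.prod volume), k x = ENNReal.ofReal (A.jac g x) * k (A.act g x) :=
    fun g => (Measure.ae_prod_iff_ae_ae (measurableSet_eq_fun hk
      ((A.measurable_jac_left g).ennreal_ofReal.mul (hk.comp (A.measurable_act_left g))))).2
        (hinv g)
  refine ⟨(μ.prod volume).withDensity k, ⟨?_⟩, fun g => ⟨A.measurable_act_left g, ?_⟩,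
    ⟨withDensity_absolutelyContinuous _ _, withDensity_absolutelyContinuous' hk.aemeasurable ?_⟩,
    hfst⟩
  · rw [← preimage_univ (f := Prod.fst), ← Measure.map_apply measurable_fst MeasurableSet.univ,
      hfst, measure_univ]
  · change ((μ.prod volume).withDensity k).map (A.act g) = _
    ext B hB
    rw [Measure.map_apply (A.measurable_act_left g) hB,
      withDensity_apply _ (A.measurable_act_left g hB), withDensity_apply _ hB,
      ← lintegral_indicator hB, ← A.lintegral_jac_mul g _ (hk.indicator hB),
      ← lintegral_indicator (A.measurable_act_left g hB)]
    refine lintegral_congr_ae ?_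
    filter_upwards [hsec g] with x hx
    by_cases hxB : A.act g x ∈ B
    · rw [indicator_of_mem (s := A.act g ⁻¹' B) hxB, indicator_of_mem hxB, hx]
    · rw [indicator_of_notMem (s := A.act g ⁻¹' B) hxB, indicator_of_notMem hxB, mul_zero]
  · exact (Measure.ae_prod_iff_ae_ae (hk (measurableSet_singleton 0)).compl).2
      (Eventually.of_forall hk0)

end Final

end WitteZimmer

end

theorem theorem5p1
    {G : Type u} [Group G] [TopologicalSpace G] [IsTopologicalGroup G] [T2Space G]
    [LocallyCompactSpace G] [MeasurableSpace G] [BorelSpace G]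
    (hG : WitteZimmer.HasPropertyT G)
    {M : Type v} [MeasurableSpace M] [StandardBorelSpace M] [MulAction G M] [MeasurableSMul₂ G M]
    (μ : Measure M) [IsProbabilityMeasure μ] [SMulInvariantMeasure G M μ]
    (α : G × M → WitteZimmer.DiffPlus) (hα : WitteZimmer.IsBorelCocycle μ α) :
    (∃ ν : Measure (M × unitInterval), IsProbabilityMeasure ν ∧
      (∀ g : G, MeasurePreserving (WitteZimmer.skewMap α g) ν ν) ∧
      (ν ≪ μ.prod volume ∧ μ.prod volume ≪ ν) ∧
      ν.map Prod.fst = μ) ∧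
    (WitteZimmer.IsBorelCocycle μ (fun p => (α p).toHomeoLeb) ∧
      WitteZimmer.Cohomologous μ (fun p : G × M => (α p).toHomeoLeb) (fun _ => 1)) := by
  obtain ⟨k, hk, hk1, hk0, hinv⟩ := WitteZimmer.exists_invariant_fiber_density hG hα
  refine ⟨WitteZimmer.exists_invariant_measure hα hk hk1 hk0 hinv,
    ⟨WitteZimmer.DiffPlus.measurable_toHomeoLeb.comp hα.1, fun g h => ?_⟩,
    WitteZimmer.cohomologous_one hk hk1 hk0 hinv⟩
  filter_upwards [hα.2 g h] with m hm
  rw [hm, map_mul]
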